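/- Let $\Gamma=\Gamma(\mathbb Z_{37},\{1,10,11\})$ be the Cayley graph with vertex set $\mathbb Z_{37}$ in which two vertices are adjacent if and only if their difference is one of $\pm1,\pm10,\pm11$. An embedding in the torus $\mathbb R^2/\mathbb Z^2$ represents vertices by distinct points and edges by simple arcs joining their ends and meeting only at common end vertices; it is a 2-cell embedding if its faces (the components of the complement) are open discs attached along the facial walks of a rotation system of the graph. The representativity of an embedding is the smallest number of intersections (counted along the curve) of a non-contractible closed curve of the torus with the embedded graph. Then: 1. every rotation system of $\Gamma$ satisfies $|V|-|E|+|F|\le 0$, where $F$ is its set of facial walks (so $\Gamma$ has no embedding in the sphere); 2. $\Gamma$ has a 2-cell embedding in the torus, and it is unique: for any two 2-cell embeddings of $\Gamma$ in the torus, there is a homeomorphism of the torus that carries each vertex and each edge of the first to the same vertex and the same edge of the second; 3. this embedding is an Eulerian triangulation, i.e., every face is an open disc, with closure a closed disc, bounded by a triangle of $\Gamma$, and all vertex degrees are even; and its representativity is exactly $7$. -/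

import Mathlib

open scoped unitInterval

noncomputable section

/-- A rotation system of a graph `G`: a permutation of the darts (edges with a direction) of `G`
that cyclically permutes the darts leaving each vertex. -/
structure RotationSystem {V : Type} (G : SimpleGraph V) where
  rot : Equiv.Perm G.Dart
  rot_fst : ∀ d : G.Dart, (rot d).fst = d.fst
  sameCycle : ∀ d d' : G.Dart, d.fst = d'.fst → rot.SameCycle d d'

namespace RotationSystem

variable {V : Type} {G : SimpleGraph V}

/-- Reversal of darts, as a permutation. -/
def dartSymm (G : SimpleGraph V) : Equiv.Perm G.Dart where
  toFun := SimpleGraph.Dart.symm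
  invFun := SimpleGraph.Dart.symm
  left_inv := SimpleGraph.Dart.symm_symm
  right_inv := SimpleGraph.Dart.symm_symm

/-- Face tracing: having traversed `d`, continue with the dart that follows the reverse of `d` in
the rotation at the head of `d`. The cycles of this permutation are the facial walks. -/
def facePerm (R : RotationSystem G) : Equiv.Perm G.Dart := (dartSymm G).trans R.rot

/-- The number of facial walks. -/
def numFaces (R : RotationSystem G) : ℕ := Nat.card (Quotient (Equiv.Perm.SameCycle.setoid R.facePerm))

/-- The length of the facial walk that traverses `d`. -/
def faceLength (R : RotationSystem G) (d : G.Dart) : ℕ := Function.minimalPeriod R.facePerm d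

/-- `|V| - |E| + |F|`. -/
def eulerChar (R : RotationSystem G) : ℤ :=
  (Nat.card V : ℤ) - (Nat.card G.edgeSet : ℤ) + (R.numFaces : ℤ)

end RotationSystem

/-- The torus `ℝ²/ℤ²`. -/
abbrev Torus : Type := UnitAddCircle × UnitAddCircle

/-- A drawing without crossings of the graph `G` on the torus: the vertices are distinct points, and
each edge is a simple arc joining its end vertices; an arc contains no other vertex, and two arcs
share no points other than end points. The arc of an edge is parameterized once for each of its two
directions. -/
structure TorusEmbedding {V : Type} (G : SimpleGraph V) where
  pt : V → Torus
  arc : G.Dart → C(I, Torus)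
  pt_injective : Function.Injective pt
  arc_zero : ∀ d : G.Dart, arc d 0 = pt d.fst
  arc_symm : ∀ (d : G.Dart) (t : I), arc d.symm t = arc d (unitInterval.symm t)
  arc_injective : ∀ d : G.Dart, Function.Injective (arc d)
  arc_eq_pt : ∀ (d : G.Dart) (t : I) (v : V), arc d t = pt v → t = 0 ∨ t = 1
  arc_disjoint : ∀ (d d' : G.Dart) (s t : I), d.edge ≠ d'.edge → arc d s = arc d' t →
    (s = 0 ∨ s = 1) ∧ (t = 0 ∨ t = 1)

namespace TorusEmbedding

variable {V : Type} {G : SimpleGraph V}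

/-- The subset of the torus occupied by the graph. -/
def support (e : TorusEmbedding G) : Set Torus :=
  Set.range e.pt ∪ ⋃ d : G.Dart, Set.range (e.arc d)

/-- The faces are the connected components of the complement of the graph. -/
def IsFace (e : TorusEmbedding G) (U : Set Torus) : Prop :=
  ∃ x ∈ e.supportᶜ, U = connectedComponentIn e.supportᶜ x

/-- `U` is an open 2-cell attached to the graph along the facial walk of `R` that starts with `d`:
there is a continuous map from the closed unit disc that restricts to a bijection from the open disc
to `U` and maps the boundary circle, cut into `n` arcs of equal length, along the successive arcs
of the facial walk, where `n` is the length of the walk. -/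
def IsCell (e : TorusEmbedding G) (R : RotationSystem G) (d : G.Dart) (U : Set Torus) : Prop :=
  ∃ f : ℂ → Torus, ContinuousOn f (Metric.closedBall 0 1) ∧
    Set.BijOn f (Metric.ball 0 1) U ∧
    ∀ (k : ℕ) (s : I),
      f (Complex.exp (2 * Real.pi * Complex.I * (((k : ℂ) + ((s : ℝ) : ℂ)) / (R.faceLength d : ℂ))))
        = e.arc (R.facePerm^[k] d) s

/-- `e` is a 2-cell embedding with rotation system `R`: the faces of `e` correspond bijectively to
the facial walks of `R`, each face being an open 2-cell bounded by its facial walk. Here `region d`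
is the face whose facial walk traverses the dart `d`. -/
def IsTwoCellWith (e : TorusEmbedding G) (R : RotationSystem G) : Prop :=
  ∃ region : G.Dart → Set Torus,
    (∀ d, e.IsFace (region d)) ∧
    (∀ U, e.IsFace U → ∃ d, region d = U) ∧
    (∀ d d', region d = region d' ↔ R.facePerm.SameCycle d d') ∧
    (∀ d, e.IsCell R d (region d))

/-- `e` is a 2-cell (cellular) embedding. -/
def IsTwoCell (e : TorusEmbedding G) : Prop := ∃ R : RotationSystem G, e.IsTwoCellWith R

/-- Two embeddings are equivalent if a homeomorphism of the torus carries each vertex and each edge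
of the first to the same vertex and the same edge of the second. -/
def Equivalent (e e' : TorusEmbedding G) : Prop :=
  ∃ h : Torus ≃ₜ Torus, (∀ v : V, h (e.pt v) = e'.pt v) ∧
    ∀ d : G.Dart, h '' Set.range (e.arc d) = Set.range (e'.arc d)

/-- Every face is an open disc, with closure a closed disc, bounded by a triangle of the graph. -/
def IsTriangulation (e : TorusEmbedding G) : Prop :=
  ∀ U, e.IsFace U → ∃ (a b c : V) (hab : G.Adj a b) (hbc : G.Adj b c) (hca : G.Adj c a)
    (f : ℂ → Torus), ContinuousOn f (Metric.closedBall 0 1) ∧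
      Set.InjOn f (Metric.closedBall 0 1) ∧
      f '' Metric.ball 0 1 = U ∧
      f '' Metric.sphere 0 1 = Set.range (e.arc ⟨(a, b), hab⟩) ∪
        Set.range (e.arc ⟨(b, c), hbc⟩) ∪ Set.range (e.arc ⟨(c, a), hca⟩)

/-- A triangulation of the torus all of whose vertices have even degree. -/
def IsEulerianTriangulation (e : TorusEmbedding G) : Prop :=
  e.IsTriangulation ∧ ∀ v : V, (G.neighborSet v).Finite ∧ Even (G.neighborSet v).ncard

/-- The representativity: the smallest number of intersections with the graph (counted along the
curve) of a non-contractible closed curve on the torus. -/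
def representativity (e : TorusEmbedding G) : ℕ∞ :=
  ⨅ γ : {γ : C(UnitAddCircle, Torus) // ¬ γ.Nullhomotopic},
    {t : UnitAddCircle | γ.1 t ∈ e.support}.encard

end TorusEmbedding

/-- The Cayley graph `Γ(ℤ₃₇, {1, 10, 11})`: two elements of `ℤ₃₇` are adjacent if and only if their
difference is one of `±1`, `±10`, `±11`. -/
def Gamma37 : SimpleGraph (ZMod 37) := SimpleGraph.addCayley {1, 10, 11}

end

/-! Upper bound on the Euler characteristic. The graph has 37 vertices of degree six, hence 111
edges and 222 darts. A facial walk has length at least three, so there are at most 74 of them and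
`37 - 111 + 74 = 0` bounds the characteristic (`Gamma37.eulerChar_nonpos`); equality forces all
facial walks to be triangles.

Lower bound for 2-cell embeddings in the torus (`TorusEmbedding.IsTwoCellWith.eulerChar_nonneg`).
Counting ranks, the integral cocycles of the rotation system have rank at least `E + 1 - F`. A
cocycle extends over the cells to a circle-valued function on the torus. Such a function has two
integral periods; when both vanish it lifts to the line and the cocycle is a coboundary. So the rank
is at most `2 + (V - 1)`, whence `V - E + F ≥ 0`, and all facial walks are triangles.

Uniqueness. The steps `±1, ±10, ±11` are the sixth roots of unity modulo 37, generated by 11. The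
steps round a triangle sum to zero, which forces each rotation to multiply steps by 11 or by its
inverse 27, with the same choice at all vertices (`Gamma37.eq_rotationSystem_or_eq_mirror`).
Reflecting the discs exchanges the two choices for one and the same embedding, and embeddings with a
common rotation system are equivalent because their closed cells glue to a homeomorphism
(`TorusEmbedding.IsTwoCellWith.equivalent`).

Existence. The map `(m, n) ↦ m + 10n` from `ℤ²` onto `ZMod 37` has kernel spanned by `(7, 3)` and
`(-3, 4)`. The triangular grid with edge directions `(1, 0)`, `(1, 1)`, `(0, 1)`, taken modulo this
kernel, is the embedding. Dividing by all of `ℤ²` instead gives a covering of degree 37 under which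
the graph is the preimage of the circles `x = 0`, `y = 0`, `x = y` (`Gamma37.mem_support_iff`).

Representativity. A closed curve with winding numbers `(p, q)` winds `7p - 3q`, `3p + 4q` and `4p -
7q` times across these three circles, and one of these numbers has absolute value at least 7 unless
`p = q = 0`. An explicit zigzag curve attains 7, and equivalence carries the value to every 2-cell
embedding. -/

open scoped unitInterval

noncomputable section

/-! ### Radial extension of functions from the circle to the disc. -/

section Cone

variable {E : Type*} [NormedAddCommGroup E] [NormedSpace ℝ E]

/-- The piecewise affine function on `ℝ` with prescribed values at the integers. -/
def piecewiseAffine (S : ℤ → E) (x : ℝ) : E := S ⌊x⌋ + Int.fract x • (S (⌊x⌋ + 1) - S ⌊x⌋)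

lemma piecewiseAffine_add (S : ℤ → E) (k : ℤ) {s : ℝ} (h0 : 0 ≤ s) (h1 : s ≤ 1) :
    piecewiseAffine S (k + s) = S k + s • (S (k + 1) - S k) := by
  rcases h1.lt_or_eq with h1 | rfl
  · have : ⌊(k : ℝ) + s⌋ = k := by
      rw [Int.floor_eq_iff]; constructor <;> linarith
    have h2 : Int.fract ((k : ℝ) + s) = s := by
      rw [Int.fract, this]; ring
    rw [piecewiseAffine, this, h2]
  · have : ⌊(k : ℝ) + 1⌋ = k + 1 := by simp
    rw [piecewiseAffine, this]
    simp

lemma continuous_piecewiseAffine (S : ℤ → E) : Continuous (piecewiseAffine S) := by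
  have hlf : LocallyFinite fun k : ℤ => Set.Icc (k : ℝ) (k + 1) := by
    intro x
    refine ⟨Set.Ioo (x - 1) (x + 1), Ioo_mem_nhds (by linarith) (by linarith), ?_⟩
    refine (Set.finite_Icc (⌊x⌋ - 2) (⌊x⌋ + 2)).subset ?_
    rintro k ⟨y, ⟨h1, h2⟩, h3, h4⟩
    have h5 := Int.floor_le x
    have h6 := Int.lt_floor_add_one x
    constructor
    · have : (⌊x⌋ : ℝ) - 2 ≤ k := by linarith
      exact_mod_cast this
    · have : (k : ℝ) ≤ ⌊x⌋ + 2 := by linarith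
      exact_mod_cast this
  refine hlf.continuous ?_ (fun k => isClosed_Icc) fun k => ?_
  · refine Set.eq_univ_of_forall fun x => Set.mem_iUnion.2 ⟨⌊x⌋, Int.floor_le x, ?_⟩
    exact (Int.lt_floor_add_one x).le
  · have : Set.EqOn (piecewiseAffine S) (fun x => S k + (x - k) • (S (k + 1) - S k))
        (Set.Icc (k : ℝ) (k + 1)) := by
      intro x hx
      have := piecewiseAffine_add S k (s := x - k) (by linarith [hx.1]) (by linarith [hx.2])
      simpa using this
    refine ContinuousOn.congr ?_ this
    fun_prop

lemma piecewiseAffine_periodic {S : ℤ → E} {n : ℕ} (hS : ∀ k, S (k + n) = S k) :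
    Function.Periodic (piecewiseAffine S) n := by
  intro x
  have h1 : ⌊x + n⌋ = ⌊x⌋ + n := Int.floor_add_natCast x n
  have h2 : Int.fract (x + n) = Int.fract x := Int.fract_add_natCast x n
  rw [piecewiseAffine, h1, h2, hS, add_right_comm, hS, piecewiseAffine]

/-- The radial extension to the plane of a function on the circle, where the circle is
parameterized by `x ↦ exp (2πix/n)`. -/
def cone (n : ℕ) (β : ℝ → E) (z : ℂ) : E := ‖z‖ • β (n * (z.arg / (2 * Real.pi)))

/-- The argument of the point and `2πx/n` differ by a multiple of `2π`, which the period `n` of `β`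
absorbs. -/
lemma cone_smul_exp {n : ℕ} (hn : 0 < n) {β : ℝ → E} (hβ : Function.Periodic β n) {r : ℝ}
    (hr : 0 ≤ r) (x : ℝ) :
    cone n β (r * Complex.exp (2 * Real.pi * Complex.I * (x / n))) = r • β x := by
  have hn' : (n : ℝ) ≠ 0 := by positivity
  rcases hr.eq_or_lt with rfl | hr
  · simp [cone]
  have he : Complex.exp (2 * Real.pi * Complex.I * (x / n)) =
      Complex.exp ((2 * Real.pi * (x / n) : ℝ) * Complex.I) := by
    congr 1; push_cast; ring
  have hnorm : ‖(r : ℂ) * Complex.exp (2 * Real.pi * Complex.I * (x / n))‖ = r := by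
    rw [he, norm_mul, Complex.norm_exp_ofReal_mul_I]
    simp [hr.le]
  rw [cone, hnorm]
  congr 1
  have harg : ((r * Complex.exp (2 * Real.pi * Complex.I * (x / n))).arg : Real.Angle) =
      ((2 * Real.pi * (x / n) : ℝ) : Real.Angle) := by
    rw [he, Complex.arg_real_mul _ hr, Complex.arg_exp_mul_I, Real.Angle.coe_toIocMod]
  rw [Real.Angle.angle_eq_iff_two_pi_dvd_sub] at harg
  obtain ⟨k, hk⟩ := harg
  have : (r * Complex.exp (2 * Real.pi * Complex.I * (x / n))).arg =
    2 * Real.pi * (x / n) + 2 * Real.pi * k := by linarith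
  rw [this]
  have h3 : n * ((2 * Real.pi * (x / n) + 2 * Real.pi * k) / (2 * Real.pi)) = x + k * n := by
    field_simp
  rw [h3]
  exact hβ.int_mul k x

/-- The jump of `arg` on the negative axis disappears modulo `2π`, so the function factors through
`Real.Angle`. At the origin the factor `‖z‖` wins, since `β` is bounded by compactness of the
circle. -/
lemma continuous_cone {n : ℕ} {β : ℝ → E} (hc : Continuous β)
    (hβ : Function.Periodic β n) : Continuous (cone n β) := by
  rw [continuous_iff_continuousAt]
  intro z
  have hper : Function.Periodic (fun θ : ℝ => β (n * (θ / (2 * Real.pi)))) (2 * Real.pi) := by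
    intro θ
    have : n * ((θ + 2 * Real.pi) / (2 * Real.pi)) = n * (θ / (2 * Real.pi)) + n := by
      field_simp
    simp only [this]
    exact hβ _
  have hlift : Continuous (hper.lift : Real.Angle → E) :=
    continuous_coinduced_dom.2 (by
      change Continuous (fun θ : ℝ => β (n * (θ / (2 * Real.pi))))
      fun_prop)
  have heq : cone n β = fun z => ‖z‖ • hper.lift (z.arg : Real.Angle) := by
    ext z; rfl
  by_cases hz : z = 0
  · subst hz
    have hb : ∃ C, ∀ a : Real.Angle, ‖hper.lift a‖ ≤ C := by
      have : CompactSpace Real.Angle :=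
        haveI : Fact (0 < 2 * Real.pi) := ⟨Real.two_pi_pos⟩
        inferInstanceAs (CompactSpace (AddCircle (2 * Real.pi)))
      obtain ⟨C, hC⟩ := (isCompact_univ (X := Real.Angle)).exists_bound_of_continuousOn
        hlift.continuousOn
      exact ⟨C, fun a => hC a trivial⟩
    obtain ⟨C, hC⟩ := hb
    rw [heq, ContinuousAt]
    simp only [norm_zero, zero_smul]
    refine squeeze_zero_norm (a := fun z : ℂ => ‖z‖ * C) (fun z => ?_) ?_
    · rw [norm_smul, norm_norm]
      exact mul_le_mul_of_nonneg_left (hC _) (norm_nonneg _)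
    · have : Continuous fun z : ℂ => ‖z‖ * C := by fun_prop
      simpa using this.tendsto 0
  · rw [heq]
    refine continuous_norm.continuousAt.smul ?_
    exact hlift.continuousAt.comp (Complex.continuousAt_arg_coe_angle hz)

end Cone

/-- Polar coordinates on a circle cut into `n` arcs. The strict bound `s < 1` assigns a cut point to
the arc that starts there; the injectivity arguments on closed cells use it. -/
lemma exists_eq_mul_exp {n : ℕ} (hn : 0 < n) (z : ℂ) : ∃ k < n, ∃ s : ℝ, 0 ≤ s ∧ s < 1 ∧
    z = ‖z‖ * Complex.exp (2 * Real.pi * Complex.I * (((k : ℝ) + s : ℝ) / n)) := by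
  have hn' : (0 : ℝ) < n := by positivity
  have hnc : (n : ℂ) ≠ 0 := by exact_mod_cast hn.ne'
  set x : ℝ := n * Int.fract (z.arg / (2 * Real.pi)) with hx
  have hx0 : 0 ≤ x := mul_nonneg hn'.le (Int.fract_nonneg _)
  have hxn : x < n := by
    have := Int.fract_lt_one (z.arg / (2 * Real.pi))
    nlinarith
  refine ⟨⌊x⌋₊, (Nat.floor_lt hx0).2 hxn, x - ⌊x⌋₊, ?_, ?_, ?_⟩
  · linarith [Nat.floor_le hx0]
  · linarith [Nat.lt_floor_add_one x]
  · have h1 : ((⌊x⌋₊ : ℝ) + (x - ⌊x⌋₊) : ℝ) = x := by ring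
    rw [h1]
    have h2 : 2 * Real.pi * Complex.I * ((x : ℂ) / n) =
        z.arg * Complex.I - ⌊z.arg / (2 * Real.pi)⌋ * (2 * Real.pi * Complex.I) := by
      rw [hx, Int.fract]
      push_cast
      have : (Real.pi : ℂ) ≠ 0 := by exact_mod_cast Real.pi_ne_zero
      field_simp
    rw [h2, Complex.exp_sub, Complex.exp_int_mul_two_pi_mul_I, div_one]
    exact (Complex.norm_mul_exp_arg_mul_I z).symm

lemma norm_exp_two_pi_mul_div (n : ℕ) (x : ℝ) :
    ‖Complex.exp (2 * Real.pi * Complex.I * (x / n))‖ = 1 := by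
  have he : Complex.exp (2 * Real.pi * Complex.I * (x / n)) =
      Complex.exp ((2 * Real.pi * (x / n) : ℝ) * Complex.I) := by
    congr 1; push_cast; ring
  rw [he, Complex.norm_exp_ofReal_mul_I]

/-! ### Permutations whose cycles have length at least three. -/

section PermOrbits

variable {α : Type*} [Finite α] {p : Equiv.Perm α}

lemma three_le_ncard_sameCycle (h1 : ∀ x, p x ≠ x) (h2 : ∀ x, p (p x) ≠ x) (x : α) :
    3 ≤ {y | p.SameCycle x y}.ncard := by
  have hsub : ({x, p x, p (p x)} : Set α) ⊆ {y | p.SameCycle x y} := by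
    rintro y (rfl | rfl | rfl)
    · exact Equiv.Perm.SameCycle.refl _ _
    · exact ⟨1, by simp⟩
    · exact ⟨2, rfl⟩
  have h3 : ({x, p x, p (p x)} : Set α).ncard = 3 := by
    rw [Set.ncard_eq_three]
    exact ⟨_, _, _, (h1 x).symm, (h2 x).symm, (h1 (p x)).symm, rfl⟩
  rw [← h3]
  exact Set.ncard_le_ncard hsub (Set.toFinite _)

lemma card_eq_sum_ncard_sameCycle [Fintype (Quotient (Equiv.Perm.SameCycle.setoid p))] :
    Nat.card α = ∑ q : Quotient (Equiv.Perm.SameCycle.setoid p),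
      {y | p.SameCycle q.out y}.ncard := by
  classical
  have := Fintype.ofFinite α
  rw [Nat.card_eq_fintype_card, ← Finset.card_univ,
    Finset.card_eq_sum_card_fiberwise (f := Quotient.mk (Equiv.Perm.SameCycle.setoid p))
      (t := Finset.univ) (fun _ _ => Finset.mem_coe.2 (Finset.mem_univ _))]
  refine Finset.sum_congr rfl fun q _ => ?_
  rw [← Set.ncard_coe_finset]
  congr 1
  ext y
  simp only [Finset.coe_filter, Finset.mem_univ, true_and, Set.mem_ofPred_eq]
  constructor
  · intro h
    exact Quotient.exact (q.out_eq.trans h.symm)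
  · intro h
    exact (q.out_eq.symm.trans (Quotient.sound h)).symm

lemma three_mul_card_sameCycle_le (h1 : ∀ x, p x ≠ x) (h2 : ∀ x, p (p x) ≠ x) :
    3 * Nat.card (Quotient (Equiv.Perm.SameCycle.setoid p)) ≤ Nat.card α := by
  have := Fintype.ofFinite (Quotient (Equiv.Perm.SameCycle.setoid p))
  rw [card_eq_sum_ncard_sameCycle (p := p), Nat.card_eq_fintype_card, mul_comm, ← smul_eq_mul]
  exact Finset.card_nsmul_le_sum _ _ _ fun q _ => three_le_ncard_sameCycle h1 h2 _

/-- The equality case of the count: if the average cycle length is at most three and no cycle is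
shorter, every cycle has exactly three elements. -/
lemma apply_apply_apply_eq_of_card_le (h1 : ∀ x, p x ≠ x) (h2 : ∀ x, p (p x) ≠ x)
    (h : Nat.card α ≤ 3 * Nat.card (Quotient (Equiv.Perm.SameCycle.setoid p))) (x : α) :
    p (p (p x)) = x := by
  have := Fintype.ofFinite (Quotient (Equiv.Perm.SameCycle.setoid p))
  have hle : ∀ q ∈ (Finset.univ : Finset (Quotient (Equiv.Perm.SameCycle.setoid p))),
      3 ≤ {y | p.SameCycle q.out y}.ncard := fun q _ => three_le_ncard_sameCycle h1 h2 _
  have heq := (Finset.sum_eq_sum_iff_of_le hle).1 (by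
    refine le_antisymm (Finset.sum_le_sum hle) ?_
    rw [← card_eq_sum_ncard_sameCycle]
    simpa [Nat.card_eq_fintype_card, mul_comm] using h)
  have hx : {y | p.SameCycle x y}.ncard = 3 := by
    rw [heq (Quotient.mk _ x) (Finset.mem_univ _)]
    congr 1
    ext y
    have : p.SameCycle (Quotient.mk (Equiv.Perm.SameCycle.setoid p) x).out x :=
      Quotient.mk_out (s := Equiv.Perm.SameCycle.setoid p) x
    exact ⟨fun h => this.trans h, fun h => this.symm.trans h⟩
  by_contra hne
  have hsub : ({x, p x, p (p x), p (p (p x))} : Set α) ⊆ {y | p.SameCycle x y} := by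
    rintro y (rfl | rfl | rfl | rfl)
    · exact Equiv.Perm.SameCycle.refl _ _
    · exact ⟨1, by simp⟩
    · exact ⟨2, rfl⟩
    · exact ⟨3, rfl⟩
  have h4 := Set.ncard_le_ncard hsub (Set.toFinite _)
  rw [hx, Set.ncard_insert_of_notMem, Set.ncard_insert_of_notMem,
    Set.ncard_pair (h1 (p (p x))).symm] at h4
  · omega
  · rintro (h | h)
    · exact h1 _ h.symm
    · exact h2 _ h.symm
  · rintro (h | h | h)
    · exact h1 _ h.symm
    · exact h2 _ h.symm
    · exact hne h.symm

end PermOrbits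

/-! ### Elementary properties of facial walks. -/

namespace RotationSystem

variable {V : Type} {G : SimpleGraph V} (R : RotationSystem G)

lemma facePerm_apply (d : G.Dart) : R.facePerm d = R.rot d.symm := rfl

lemma facePerm_fst (d : G.Dart) : (R.facePerm d).fst = d.snd := R.rot_fst _

lemma rot_eq_facePerm (d : G.Dart) : R.rot d = R.facePerm d.symm := by
  rw [facePerm_apply, SimpleGraph.Dart.symm_symm]

lemma rot_ne {d d' : G.Dart} (h : d.fst = d'.fst) (hne : d ≠ d') : R.rot d ≠ d :=
  fun hd => hne ((R.sameCycle d d' h).eq_of_left hd)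

lemma facePerm_ne (d : G.Dart) : R.facePerm d ≠ d := fun h =>
  d.adj.ne (by rw [← R.facePerm_fst d, h])

/-- A facial walk of length two returns along its own edge, so the rotation would fix the reversed
dart. -/
lemma facePerm_facePerm_ne (h : ∀ d, R.rot d ≠ d) (d : G.Dart) :
    R.facePerm (R.facePerm d) ≠ d := by
  intro hd
  refine h d.symm ?_
  rw [← facePerm_apply]
  apply SimpleGraph.Dart.ext
  refine Prod.ext (R.facePerm_fst d) ?_
  change (R.facePerm d).snd = d.fst
  rw [← R.facePerm_fst, hd]

instance [Finite V] : Finite G.Dart := Finite.of_injective _ SimpleGraph.Dart.toProd_injective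

lemma faceLength_pos [Finite V] (d : G.Dart) : 0 < R.faceLength d :=
  Function.minimalPeriod_pos_of_mem_periodicPts
    ((Function.Injective.mem_periodicPts R.facePerm.injective) d)

lemma facePerm_iterate_add_faceLength (d : G.Dart) (k : ℕ) :
    R.facePerm^[k + R.faceLength d] d = R.facePerm^[k] d := by
  rw [Function.iterate_add_apply, faceLength, Function.iterate_minimalPeriod]

lemma sameCycle_iff_exists_iterate [Finite V] {d d' : G.Dart} :
    R.facePerm.SameCycle d d' ↔ ∃ k < R.faceLength d, R.facePerm^[k] d = d' := by
  constructor
  · intro h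
    obtain ⟨k, -, hk⟩ := h.exists_pow_eq'
    refine ⟨k % R.faceLength d, Nat.mod_lt _ (R.faceLength_pos d), ?_⟩
    rw [faceLength, Function.iterate_mod_minimalPeriod_eq, ← hk, Equiv.Perm.iterate_eq_pow]
  · rintro ⟨k, -, rfl⟩
    exact ⟨k, by rw [Equiv.Perm.iterate_eq_pow]; rfl⟩

lemma faceLength_eq_three (h3 : ∀ d, R.facePerm (R.facePerm (R.facePerm d)) = d) (d : G.Dart) :
    R.faceLength d = 3 := by
  have : Fact (Nat.Prime 3) := ⟨Nat.prime_three⟩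
  exact Function.minimalPeriod_eq_prime (h3 d) (R.facePerm_ne d)

/-- The rotation system with all rotations reversed. -/
def mirror : RotationSystem G where
  rot := R.rot⁻¹
  rot_fst d := by
    rw [← R.rot_fst]
    exact congrArg (fun d => d.fst) (R.rot.apply_symm_apply d)
  sameCycle d d' h := (R.sameCycle d d' h).inv

end RotationSystem

/-! ### Gluing closed cells; embeddings with the same rotation system. -/

namespace TorusEmbedding

variable {V : Type} {G : SimpleGraph V} {e e' : TorusEmbedding G} {R : RotationSystem G}

lemma arc_one (e : TorusEmbedding G) (d : G.Dart) : e.arc d 1 = e.pt d.snd := by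
  have h := e.arc_symm d 0
  rw [unitInterval.symm_zero, e.arc_zero] at h
  exact h.symm

lemma arc_mem_support (e : TorusEmbedding G) (d : G.Dart) (s : I) : e.arc d s ∈ e.support :=
  Or.inr (Set.mem_iUnion.2 ⟨d, s, rfl⟩)

lemma IsFace.subset_compl {U : Set Torus} (hU : e.IsFace U) : U ⊆ e.supportᶜ := by
  obtain ⟨x, -, rfl⟩ := hU
  exact connectedComponentIn_subset _ _

lemma IsFace.eq_of_mem {U U' : Set Torus} (hU : e.IsFace U) (hU' : e.IsFace U') {x : Torus}
    (h : x ∈ U) (h' : x ∈ U') : U = U' := by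
  obtain ⟨y, -, rfl⟩ := hU
  obtain ⟨y', -, rfl⟩ := hU'
  rw [connectedComponentIn_eq h, connectedComponentIn_eq h']

/-- The faces of a 2-cell embedding, with a choice of a cell map for each facial walk and each
of its starting darts. -/
structure CellData (e : TorusEmbedding G) (R : RotationSystem G) where
  region : G.Dart → Set Torus
  isFace : ∀ d, e.IsFace (region d)
  exists_region_eq : ∀ U, e.IsFace U → ∃ d, region d = U
  region_eq_iff : ∀ d d', region d = region d' ↔ R.facePerm.SameCycle d d'
  cell : G.Dart → ℂ → Torus
  continuousOn : ∀ d, ContinuousOn (cell d) (Metric.closedBall 0 1)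
  bijOn : ∀ d, Set.BijOn (cell d) (Metric.ball 0 1) (region d)
  boundary : ∀ (d : G.Dart) (k : ℕ) (s : I),
    cell d (Complex.exp (2 * Real.pi * Complex.I *
      (((k : ℂ) + ((s : ℝ) : ℂ)) / (R.faceLength d : ℂ)))) = e.arc (R.facePerm^[k] d) s

lemma IsTwoCellWith.nonempty_cellData (h : e.IsTwoCellWith R) : Nonempty (CellData e R) := by
  obtain ⟨region, h1, h2, h3, h4⟩ := h
  choose cell hc hb hbd using h4
  exact ⟨⟨region, h1, h2, h3, cell, hc, hb, hbd⟩⟩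

lemma exists_exp_of_norm_eq_one {n : ℕ} (hn : 0 < n) {z : ℂ} (hz : ‖z‖ = 1) :
    ∃ k < n, ∃ s : I, s ≠ 1 ∧
      z = Complex.exp (2 * Real.pi * Complex.I * (((k : ℂ) + ((s : ℝ) : ℂ)) / n)) := by
  obtain ⟨k, hk, s, hs0, hs1, h⟩ := exists_eq_mul_exp hn z
  refine ⟨k, hk, ⟨s, hs0, hs1.le⟩, fun h => hs1.ne (congrArg Subtype.val h), ?_⟩
  rw [hz] at h
  simpa using h

lemma exp_mem_sphere (n k : ℕ) (s : I) :
    Complex.exp (2 * Real.pi * Complex.I * (((k : ℂ) + ((s : ℝ) : ℂ)) / n)) ∈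
      Metric.sphere (0 : ℂ) 1 := by
  have := norm_exp_two_pi_mul_div n (k + s)
  rw [mem_sphere_zero_iff_norm, ← this]
  push_cast
  rfl

lemma exp_mem_closedBall (n k : ℕ) (s : I) :
    Complex.exp (2 * Real.pi * Complex.I * (((k : ℂ) + ((s : ℝ) : ℂ)) / n)) ∈
      Metric.closedBall (0 : ℂ) 1 :=
  Metric.sphere_subset_closedBall (exp_mem_sphere n k s)

namespace CellData

/-- One cell per facial walk, that of the representative `q.out`, is kept; every arc still lies on
the boundary of such a cell. -/
lemma exists_arc_eq_cell [Finite V] (C : CellData e R) (d : G.Dart) (s : I) :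
    ∃ (q : Quotient (Equiv.Perm.SameCycle.setoid R.facePerm)) (k : ℕ),
      R.facePerm^[k] q.out = d ∧ C.cell q.out (Complex.exp (2 * Real.pi * Complex.I *
        (((k : ℂ) + ((s : ℝ) : ℂ)) / (R.faceLength q.out : ℂ)))) = e.arc d s := by
  refine ⟨Quotient.mk _ d, ?_⟩
  obtain ⟨k, -, hk⟩ := R.sameCycle_iff_exists_iterate.1
    (Quotient.mk_out (s := Equiv.Perm.SameCycle.setoid R.facePerm) d)
  exact ⟨k, hk, by rw [C.boundary, hk]⟩

/-- The closed cells cover the torus. Vertices are reached only as ends of arcs, hence the condition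
that none is isolated. -/
lemma exists_cell_eq [Finite V] (C : CellData e R) (hV : ∀ v, ∃ d : G.Dart, d.fst = v)
    (x : Torus) : ∃ q : Quotient (Equiv.Perm.SameCycle.setoid R.facePerm),
      ∃ z ∈ Metric.closedBall (0 : ℂ) 1, C.cell q.out z = x := by
  have harc : ∀ (d : G.Dart) (s : I), ∃ q : Quotient (Equiv.Perm.SameCycle.setoid R.facePerm),
      ∃ z ∈ Metric.closedBall (0 : ℂ) 1, C.cell q.out z = e.arc d s := fun d s => by
    obtain ⟨q, k, -, h⟩ := C.exists_arc_eq_cell d s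
    exact ⟨q, _, exp_mem_closedBall _ k s, h⟩
  by_cases hx : x ∈ e.support
  · rcases hx with ⟨v, rfl⟩ | hx
    · obtain ⟨d, rfl⟩ := hV v
      rw [← e.arc_zero]
      exact harc d 0
    · obtain ⟨d, s, rfl⟩ := Set.mem_iUnion.1 hx
      exact harc d s
  · obtain ⟨d, hd⟩ := C.exists_region_eq _ ⟨x, hx, rfl⟩
    have hq : C.region (Quotient.mk (Equiv.Perm.SameCycle.setoid R.facePerm) d).out = C.region d :=
      (C.region_eq_iff _ _).2 (Quotient.mk_out (s := Equiv.Perm.SameCycle.setoid R.facePerm) d)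
    have hx' : x ∈ C.region (Quotient.mk (Equiv.Perm.SameCycle.setoid R.facePerm) d).out := by
      rw [hq, hd]
      exact mem_connectedComponentIn hx
    obtain ⟨z, hz, hzx⟩ := (C.bijOn _).surjOn hx'
    exact ⟨_, z, Metric.ball_subset_closedBall hz, hzx⟩

lemma cell_notMem_support (C : CellData e R) {d : G.Dart} {z : ℂ}
    (hz : z ∈ Metric.ball (0 : ℂ) 1) : C.cell d z ∉ e.support :=
  (C.isFace d).subset_compl ((C.bijOn d).mapsTo hz)

lemma exists_cell_eq_arc [Finite V] (C : CellData e R) (d : G.Dart) {z : ℂ}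
    (hz : z ∈ Metric.sphere (0 : ℂ) 1) : ∃ k < R.faceLength d, ∃ s : I, s ≠ 1 ∧
      z = Complex.exp (2 * Real.pi * Complex.I *
        (((k : ℂ) + ((s : ℝ) : ℂ)) / (R.faceLength d : ℂ))) ∧
      C.cell d z = e.arc (R.facePerm^[k] d) s := by
  obtain ⟨k, hk, s, hs, h⟩ := exists_exp_of_norm_eq_one (R.faceLength_pos d)
    (mem_sphere_zero_iff_norm.1 hz)
  exact ⟨k, hk, s, hs, h, by rw [h, C.boundary]⟩

end CellData

/-- A family of maps on the darts that is compatible with the incidences of the graph depends only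
on the points of the embedded graph. -/
lemma apply_eq_of_arc_eq {Y : Type*} {v : V → Y} {A : G.Dart → I → Y}
    (hA0 : ∀ d, A d 0 = v d.fst) (hAs : ∀ d t, A d.symm t = A d (unitInterval.symm t))
    {d d' : G.Dart} {s s' : I} (h : e.arc d s = e.arc d' s') : A d s = A d' s' := by
  have hA1 : ∀ d, A d 1 = v d.snd := fun d => by
    have h := hAs d 0
    rw [unitInterval.symm_zero, hA0] at h
    exact h.symm
  by_cases hdd : d.edge = d'.edge
  · rcases (SimpleGraph.dart_edge_eq_iff d d').1 hdd with rfl | rfl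
    · rw [e.arc_injective d h]
    · rw [e.arc_symm] at h
      rw [hAs, e.arc_injective d' h]
  · obtain ⟨h1, h2⟩ := e.arc_disjoint d d' s s' hdd h
    rcases h1 with rfl | rfl <;> rcases h2 with rfl | rfl <;>
      simp only [e.arc_zero, e.arc_one, e.pt_injective.eq_iff] at h <;>
      simp only [hA0, hA1, h]

namespace CellData

/-- Continuous maps on the closed cells that agree on the graph glue to a continuous map on the
torus. -/
theorem exists_glue [Finite V] (C : CellData e R) (hV : ∀ v, ∃ d : G.Dart, d.fst = v)
    {Y : Type*} [TopologicalSpace Y] {v : V → Y} {A : G.Dart → I → Y}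
    (hA0 : ∀ d, A d 0 = v d.fst) (hAs : ∀ d t, A d.symm t = A d (unitInterval.symm t))
    {g : G.Dart → ℂ → Y} (hg : ∀ d, ContinuousOn (g d) (Metric.closedBall 0 1))
    (hb : ∀ (d : G.Dart) (k : ℕ) (s : I), g d (Complex.exp (2 * Real.pi * Complex.I *
      (((k : ℂ) + ((s : ℝ) : ℂ)) / (R.faceLength d : ℂ)))) = A (R.facePerm^[k] d) s) :
    ∃ u : C(Torus, Y), ∀ q : Quotient (Equiv.Perm.SameCycle.setoid R.facePerm),
      ∀ z ∈ Metric.closedBall (0 : ℂ) 1, u (C.cell q.out z) = g q.out z := by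
  let X := Σ _ : Quotient (Equiv.Perm.SameCycle.setoid R.facePerm), Metric.closedBall (0 : ℂ) 1
  let P : C(X, Torus) := ⟨fun x => C.cell x.1.out x.2, continuous_sigma fun q =>
    continuousOn_iff_continuous_domRestrict.1 (C.continuousOn q.out)⟩
  let g' : C(X, Y) := ⟨fun x => g x.1.out x.2, continuous_sigma fun q =>
    continuousOn_iff_continuous_domRestrict.1 (hg q.out)⟩
  have hPs : Function.Surjective P := fun x => by
    obtain ⟨q, z, hz, h⟩ := C.exists_cell_eq hV x
    exact ⟨⟨q, z, hz⟩, h⟩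
  have : CompactSpace (Metric.closedBall (0 : ℂ) 1) :=
    isCompact_iff_compactSpace.1 (isCompact_closedBall 0 1)
  -- A continuous surjection from the compact disjoint union of discs to the Hausdorff torus is
  -- closed, hence a quotient map.
  have hPq : Topology.IsQuotientMap P := P.continuous.isClosedMap.isQuotientMap P.continuous hPs
  -- Interior points are identified only with themselves, and never with boundary points because
  -- they lie off the graph. On boundaries the prescribed values depend only on the point of the
  -- graph.
  have hcompat : ∀ x x' : X, P x = P x' → g' x = g' x' := by
    rintro ⟨q, z, hz⟩ ⟨q', z', hz'⟩ h
    change C.cell q.out z = C.cell q'.out z' at h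
    change g q.out z = g q'.out z'
    rw [← Metric.ball_union_sphere] at hz hz'
    rcases hz with hz | hz <;> rcases hz' with hz' | hz'
    · have h1 := (C.bijOn q.out).mapsTo hz
      have h2 := (C.bijOn q'.out).mapsTo hz'
      rw [h] at h1
      have hs := (C.region_eq_iff _ _).1 ((C.isFace _).eq_of_mem (C.isFace _) h1 h2)
      have hq : q = q' := by
        rw [← q.out_eq, ← q'.out_eq]
        exact Quotient.sound hs
      subst hq
      rw [(C.bijOn q.out).injOn hz hz' h]
    · obtain ⟨k, -, s, -, -, hs⟩ := C.exists_cell_eq_arc q'.out hz'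
      exact (C.cell_notMem_support hz (by rw [h, hs]; exact e.arc_mem_support _ _)).elim
    · obtain ⟨k, -, s, -, -, hs⟩ := C.exists_cell_eq_arc q.out hz
      exact (C.cell_notMem_support hz' (by rw [← h, hs]; exact e.arc_mem_support _ _)).elim
    · obtain ⟨k, -, s, -, hz1, hs⟩ := C.exists_cell_eq_arc q.out hz
      obtain ⟨k', -, s', -, hz1', hs'⟩ := C.exists_cell_eq_arc q'.out hz'
      rw [hz1, hz1', hb, hb]
      exact apply_eq_of_arc_eq hA0 hAs (by rw [← hs, h, hs'])
  have hfac : Function.FactorsThrough g' P := fun x x' h => hcompat x x' h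
  refine ⟨hPq.lift g' hfac, fun q z hz => ?_⟩
  exact DFunLike.congr_fun (hPq.lift_comp g' hfac) (⟨q, z, hz⟩ : X)

lemma glue_arc [Finite V] (C : CellData e R) {Y : Type*} [TopologicalSpace Y]
    {A : G.Dart → I → Y} {g : G.Dart → ℂ → Y}
    (hb : ∀ (d : G.Dart) (k : ℕ) (s : I), g d (Complex.exp (2 * Real.pi * Complex.I *
      (((k : ℂ) + ((s : ℝ) : ℂ)) / (R.faceLength d : ℂ)))) = A (R.facePerm^[k] d) s)
    {u : C(Torus, Y)} (hu : ∀ q : Quotient (Equiv.Perm.SameCycle.setoid R.facePerm),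
      ∀ z ∈ Metric.closedBall (0 : ℂ) 1, u (C.cell q.out z) = g q.out z) (d : G.Dart) (s : I) :
    u (e.arc d s) = A d s := by
  obtain ⟨q, k, hk, h⟩ := C.exists_arc_eq_cell d s
  rw [← h, hu _ _ (exp_mem_closedBall _ k s), hb, hk]

end CellData

/-- Two 2-cell embeddings with the same rotation system are equivalent. -/
theorem IsTwoCellWith.equivalent [Finite V] (hV : ∀ v, ∃ d : G.Dart, d.fst = v)
    (h : e.IsTwoCellWith R) (h' : e'.IsTwoCellWith R) : e.Equivalent e' := by
  obtain ⟨C⟩ := h.nonempty_cellData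
  obtain ⟨C'⟩ := h'.nonempty_cellData
  -- The cell maps of `e'` serve as data on the cells of `e`, so `u` carries each cell map of `e` to
  -- that of `e'`; exchanging the roles gives the inverse.
  obtain ⟨u, hu⟩ := C.exists_glue hV (v := e'.pt) (A := fun d => e'.arc d) e'.arc_zero e'.arc_symm
    C'.continuousOn C'.boundary
  obtain ⟨u', hu'⟩ := C'.exists_glue hV (v := e.pt) (A := fun d => e.arc d) e.arc_zero e.arc_symm
    C.continuousOn C.boundary
  have harc := C.glue_arc (A := fun d => e'.arc d) C'.boundary hu
  let homeo : Torus ≃ₜ Torus :=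
    { toFun := u
      invFun := u'
      left_inv := fun x => by
        obtain ⟨q, z, hz, rfl⟩ := C.exists_cell_eq hV x
        rw [hu q z hz, hu' q z hz]
      right_inv := fun x => by
        obtain ⟨q, z, hz, rfl⟩ := C'.exists_cell_eq hV x
        rw [hu' q z hz, hu q z hz]
      continuous_toFun := u.continuous
      continuous_invFun := u'.continuous }
  refine ⟨homeo, fun v => ?_, fun d => ?_⟩
  · obtain ⟨d, rfl⟩ := hV v
    rw [← e.arc_zero, ← e'.arc_zero]
    exact harc d 0
  · rw [← Set.range_comp]
    exact congrArg Set.range (funext (harc d))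

end TorusEmbedding

/-! ### Reversal of a rotation system. -/

namespace RotationSystem

variable {V : Type} {G : SimpleGraph V} (R : RotationSystem G)

/-- The facial walks of the reversed system are the old ones run backwards. -/
lemma mirror_facePerm_symm (d : G.Dart) :
    (R.mirror.facePerm (R.facePerm d).symm) = d.symm := by
  rw [facePerm_apply, SimpleGraph.Dart.symm_symm, facePerm_apply]
  exact R.rot.symm_apply_apply _

lemma mirror_facePerm_iterate_symm (d : G.Dart) (k : ℕ) :
    R.mirror.facePerm^[k] (R.facePerm^[k] d).symm = d.symm := by
  induction k with
  | zero => rfl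
  | succ k ih => rw [Function.iterate_succ_apply, Function.iterate_succ_apply',
      mirror_facePerm_symm, ih]

lemma mirror_mirror : R.mirror.mirror = R := by
  cases R
  rfl

lemma mirror_facePerm_iterate_eq_iff (d : G.Dart) (k : ℕ) :
    R.mirror.facePerm^[k] d.symm = d.symm ↔ R.facePerm^[k] d = d := by
  constructor
  · intro h
    have h1 := R.mirror.mirror_facePerm_iterate_symm d.symm k
    rwa [h, mirror_mirror, SimpleGraph.Dart.symm_symm] at h1
  · intro h
    have h1 := R.mirror_facePerm_iterate_symm d k
    rwa [h] at h1

lemma mirror_faceLength (d : G.Dart) : R.mirror.faceLength d = R.faceLength d.symm := by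
  refine Function.minimalPeriod_eq_minimalPeriod_iff.2 fun k => ?_
  have := R.mirror_facePerm_iterate_eq_iff d.symm k
  rwa [SimpleGraph.Dart.symm_symm] at this

lemma SameCycle.mirror [Finite V] {d d' : G.Dart} (h : R.facePerm.SameCycle d d') :
    R.mirror.facePerm.SameCycle d.symm d'.symm := by
  obtain ⟨k, -, rfl⟩ := R.sameCycle_iff_exists_iterate.1 h
  refine Equiv.Perm.SameCycle.symm ⟨k, ?_⟩
  rw [← R.mirror_facePerm_iterate_symm d k, Equiv.Perm.iterate_eq_pow]
  rfl

lemma sameCycle_mirror_iff [Finite V] {d d' : G.Dart} :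
    R.facePerm.SameCycle d.symm d'.symm ↔ R.mirror.facePerm.SameCycle d d' := by
  constructor
  · intro h
    simpa using SameCycle.mirror R h
  · intro h
    simpa [mirror_mirror] using SameCycle.mirror R.mirror h

end RotationSystem

namespace TorusEmbedding

variable {V : Type} {G : SimpleGraph V} {e : TorusEmbedding G} {R : RotationSystem G}

/-- A 2-cell embedding with rotation system `R` is one with the reversed rotation system. -/
theorem IsTwoCellWith.mirror [Finite V] (h : e.IsTwoCellWith R) : e.IsTwoCellWith R.mirror := by
  obtain ⟨C⟩ := h.nonempty_cellData
  refine ⟨fun d => C.region d.symm, fun d => C.isFace _, fun U hU => ?_, fun d d' => ?_,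
    fun d => ?_⟩
  · obtain ⟨d, rfl⟩ := C.exists_region_eq U hU
    exact ⟨d.symm, congrArg C.region d.symm_symm⟩
  · rw [C.region_eq_iff, R.sameCycle_mirror_iff]
  · set n := R.faceLength d.symm with hn
    have hnpos : 0 < n := R.faceLength_pos _
    have hnc : (n : ℂ) ≠ 0 := by exact_mod_cast hnpos.ne'
    -- Conjugation reverses the boundary circle; the turn by one arc then makes arc 0 go to itself
    -- reversed. Arc `k` at `s` goes to arc `-k` at `1 - s`.
    set w : ℂ := Complex.exp (2 * Real.pi * Complex.I * ((1 : ℝ) / n)) with hw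
    have hwn : ‖w‖ = 1 := norm_exp_two_pi_mul_div n 1
    have hw0 : w ≠ 0 := Complex.exp_ne_zero _
    let m : ℂ → ℂ := fun z => w * (starRingEnd ℂ) z
    have hmn : ∀ z, ‖m z‖ = ‖z‖ := fun z => by simp [m, hwn]
    have hmc : Continuous m := by fun_prop
    have hmi : Function.Injective m := fun z z' hz => by
      have := mul_left_cancel₀ hw0 hz
      exact (starRingEnd ℂ).injective this
    have hms : ∀ z, ∃ z', m z' = z := fun z => ⟨(starRingEnd ℂ) (w⁻¹ * z), by
      simp [m, hw0]⟩
    refine ⟨fun z => C.cell d.symm (m z), ?_, ⟨?_, ?_, ?_⟩, fun k s => ?_⟩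
    · refine (C.continuousOn d.symm).comp hmc.continuousOn fun z hz => ?_
      simpa [hmn] using hz
    · intro z hz
      exact (C.bijOn d.symm).mapsTo (by simpa [hmn] using hz)
    · intro z hz z' hz' h
      exact hmi ((C.bijOn d.symm).injOn (by simpa [hmn] using hz) (by simpa [hmn] using hz') h)
    · intro x hx
      obtain ⟨z, hz, rfl⟩ := (C.bijOn d.symm).surjOn hx
      obtain ⟨z', rfl⟩ := hms z
      exact ⟨z', by simpa [hmn] using hz, rfl⟩
    · rw [R.mirror_faceLength, ← hn]
      -- `(n - 1) * k` is a natural number congruent to `-k` modulo `n`.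
      have hbd := C.boundary d.symm ((n - 1) * k) (unitInterval.symm s)
      rw [← hn] at hbd
      have h1 : m (Complex.exp (2 * Real.pi * Complex.I * (((k : ℂ) + ((s : ℝ) : ℂ)) / n))) =
          Complex.exp (2 * Real.pi * Complex.I *
            (((((n - 1) * k : ℕ) : ℂ) + ((unitInterval.symm s : ℝ) : ℂ)) / n)) := by
        simp only [m, hw]
        rw [← Complex.exp_conj, ← Complex.exp_add, Complex.exp_eq_exp_iff_exists_int]
        refine ⟨-k, ?_⟩
        simp only [map_mul, map_div₀, map_add, Complex.conj_ofReal, Complex.conj_I, map_natCast,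
          map_ofNat, unitInterval.coe_symm_eq]
        rw [Nat.cast_mul, Nat.cast_sub hnpos]
        push_cast
        field_simp
        ring
      change C.cell d.symm (m _) = _
      rw [h1, hbd, ← e.arc_symm]
      congr 2
      have h2 : R.facePerm^[k] (R.facePerm^[(n - 1) * k] d.symm) = d.symm := by
        rw [← Function.iterate_add_apply]
        have : k + (n - 1) * k = n * k := by
          have hn1 : 1 + (n - 1) = n := by omega
          nth_rw 1 [← one_mul k]
          rw [← add_mul, hn1]
        rw [this]
        exact (Function.isPeriodicPt_minimalPeriod _ _).mul_const k
      have h3 := R.mirror_facePerm_iterate_symm (R.facePerm^[(n - 1) * k] d.symm) k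
      rw [h2, SimpleGraph.Dart.symm_symm] at h3
      exact h3.symm

end TorusEmbedding

/-! ### Periods of circle-valued functions on the torus. -/

section Periods

lemma unitAddCircle_coe_eq_zero_iff {x : ℝ} : (x : UnitAddCircle) = 0 ↔ ∃ m : ℤ, x = m := by
  rw [AddCircle.coe_eq_zero_iff]
  simp only [zsmul_eq_mul, mul_one, eq_comm]

lemma unitAddCircle_coe_eq_coe_iff {x y : ℝ} :
    (x : UnitAddCircle) = y ↔ ∃ m : ℤ, x = y + m := by
  rw [← sub_eq_zero, ← AddCircle.coe_sub, unitAddCircle_coe_eq_zero_iff]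
  simp only [sub_eq_iff_eq_add, add_comm]

lemma unitAddCircle_coe_int (m : ℤ) : ((m : ℝ) : UnitAddCircle) = 0 :=
  unitAddCircle_coe_eq_zero_iff.2 ⟨m, rfl⟩

/-- Applied to differences of lifts: two lifts of the same function differ by a constant integer,
which is the source of periods and winding numbers. -/
lemma exists_int_of_coe_eq_zero {X : Type*} [TopologicalSpace X] [PreconnectedSpace X]
    [Nonempty X] {f : X → ℝ} (hf : Continuous f) (h : ∀ x, (f x : UnitAddCircle) = 0) :
    ∃ m : ℤ, ∀ x, f x = m := by
  choose n hn using fun x => unitAddCircle_coe_eq_zero_iff.1 (h x)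
  have hc : Continuous n := by
    rw [Int.isClosedEmbedding_coe_real.isInducing.continuous_iff]
    exact hf.congr hn
  obtain ⟨x₀⟩ := ‹Nonempty X›
  exact ⟨n x₀, fun x => by rw [hn, PreconnectedSpace.constant inferInstance hc (y := x₀)]⟩

/-- Circle-valued maps on simply connected spaces lift to the line. -/
lemma exists_lift_of_simplyConnected {A : Type*} [TopologicalSpace A] [SimplyConnectedSpace A]
    [LocallyPathConnectedSpace A] (u : C(A, UnitAddCircle)) :
    ∃ f : C(A, ℝ), ∀ x, (f x : UnitAddCircle) = u x := by
  obtain ⟨a⟩ : Nonempty A := inferInstance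
  obtain ⟨y, hy⟩ := QuotientAddGroup.mk_surjective (u a)
  obtain ⟨f, ⟨-, hf⟩, -⟩ :=
    (AddCircle.isCoveringMap_coe (1 : ℝ)).existsUnique_continuousMap_lifts u a y hy
  exact ⟨f, fun x => congrFun hf x⟩

/-- The projection from the plane to the torus. -/
def torusMk : C(ℝ × ℝ, Torus) where
  toFun x := (x.1, x.2)
  continuous_toFun := by
    exact ((AddCircle.continuous_mk' 1).comp continuous_fst).prodMk
      ((AddCircle.continuous_mk' 1).comp continuous_snd)

lemma isOpenQuotientMap_torusMk : IsOpenQuotientMap torusMk := by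
  have h : IsOpenQuotientMap ((↑) : ℝ → UnitAddCircle) := QuotientAddGroup.isOpenQuotientMap_mk
  exact h.prodMap h

lemma torusMk_eq_iff {x y : ℝ × ℝ} :
    torusMk x = torusMk y ↔ ∃ m n : ℤ, x = (y.1 + m, y.2 + n) := by
  constructor
  · intro h
    obtain ⟨m, hm⟩ := unitAddCircle_coe_eq_coe_iff.1 (congrArg Prod.fst h)
    obtain ⟨n, hn⟩ := unitAddCircle_coe_eq_coe_iff.1 (congrArg Prod.snd h)
    exact ⟨m, n, Prod.ext hm hn⟩
  · rintro ⟨m, n, rfl⟩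
    exact Prod.ext (unitAddCircle_coe_eq_coe_iff.2 ⟨m, rfl⟩)
      (unitAddCircle_coe_eq_coe_iff.2 ⟨n, rfl⟩)

/-- `f` lifts a circle-valued function on the torus, and `p` are its periods. -/
def IsTorusLift (u : C(Torus, UnitAddCircle)) (f : C(ℝ × ℝ, ℝ)) (p : ℤ × ℤ) : Prop :=
  (∀ x, (f x : UnitAddCircle) = u (torusMk x)) ∧
    ∀ x y, f (x + 1, y) = f (x, y) + p.1 ∧ f (x, y + 1) = f (x, y) + p.2

lemma exists_isTorusLift (u : C(Torus, UnitAddCircle)) : ∃ f p, IsTorusLift u f p := by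
  obtain ⟨f, hf⟩ := exists_lift_of_simplyConnected (u.comp torusMk)
  have h1 : ∀ x : ℝ × ℝ, ((f (x.1 + 1, x.2) - f x : ℝ) : UnitAddCircle) = 0 := fun x => by
    rw [AddCircle.coe_sub, hf, hf, sub_eq_zero]
    exact congrArg u (torusMk_eq_iff.2 ⟨1, 0, by simp⟩)
  have h2 : ∀ x : ℝ × ℝ, ((f (x.1, x.2 + 1) - f x : ℝ) : UnitAddCircle) = 0 := fun x => by
    rw [AddCircle.coe_sub, hf, hf, sub_eq_zero]
    exact congrArg u (torusMk_eq_iff.2 ⟨0, 1, by simp⟩)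
  obtain ⟨m, hm⟩ := exists_int_of_coe_eq_zero (by fun_prop) h1
  obtain ⟨n, hn⟩ := exists_int_of_coe_eq_zero (by fun_prop) h2
  exact ⟨f, (m, n), hf, fun x y => ⟨by linarith [hm (x, y)], by linarith [hn (x, y)]⟩⟩

lemma IsTorusLift.add {u u' : C(Torus, UnitAddCircle)} {f f' : C(ℝ × ℝ, ℝ)} {p p' : ℤ × ℤ}
    (h : IsTorusLift u f p) (h' : IsTorusLift u' f' p') :
    IsTorusLift (u + u') (f + f') (p + p') := by
  refine ⟨fun x => ?_, fun x y => ⟨?_, ?_⟩⟩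
  · simp [h.1, h'.1]
  · have h1 := (h.2 x y).1
    have h2 := (h'.2 x y).1
    simp only [ContinuousMap.add_apply, h1, h2, Prod.fst_add, Int.cast_add]
    ring
  · have h1 := (h.2 x y).2
    have h2 := (h'.2 x y).2
    simp only [ContinuousMap.add_apply, h1, h2, Prod.snd_add, Int.cast_add]
    ring

lemma IsTorusLift.periods_eq {u : C(Torus, UnitAddCircle)} {f f' : C(ℝ × ℝ, ℝ)} {p p' : ℤ × ℤ}
    (h : IsTorusLift u f p) (h' : IsTorusLift u f' p') : p = p' := by
  obtain ⟨m, hm⟩ := exists_int_of_coe_eq_zero (f := fun x => f x - f' x) (by fun_prop)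
    (fun x => by rw [AddCircle.coe_sub, h.1, h'.1, sub_self])
  have h00 := hm (0, 0)
  have h10 := hm (0 + 1, 0)
  have h01 := hm (0, 0 + 1)
  simp only [(h.2 0 0).1, (h'.2 0 0).1, (h.2 0 0).2, (h'.2 0 0).2] at h00 h10 h01
  refine Prod.ext ?_ ?_
  · have : (p.1 : ℝ) = p'.1 := by linarith
    exact_mod_cast this
  · have : (p.2 : ℝ) = p'.2 := by linarith
    exact_mod_cast this

/-- The periods of a circle-valued function on the torus. -/
def torusPeriods : C(Torus, UnitAddCircle) →+ ℤ × ℤ :=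
  AddMonoidHom.mk' (fun u => (exists_isTorusLift u).choose_spec.choose) fun u u' =>
    (exists_isTorusLift (u + u')).choose_spec.choose_spec.periods_eq
      ((exists_isTorusLift u).choose_spec.choose_spec.add
        (exists_isTorusLift u').choose_spec.choose_spec)

lemma exists_isTorusLift_torusPeriods (u : C(Torus, UnitAddCircle)) :
    ∃ f, IsTorusLift u f (torusPeriods u) :=
  ⟨_, (exists_isTorusLift u).choose_spec.choose_spec⟩

/-- A circle-valued function on the torus without periods lifts to a real-valued function. -/
lemma exists_lift_of_torusPeriods_eq_zero {u : C(Torus, UnitAddCircle)}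
    (h : torusPeriods u = 0) : ∃ ρ : C(Torus, ℝ), ∀ x, (ρ x : UnitAddCircle) = u x := by
  obtain ⟨f, hf, hp⟩ := exists_isTorusLift_torusPeriods u
  simp only [h, Prod.fst_zero, Prod.snd_zero, Int.cast_zero, add_zero] at hp
  have hfac : Function.FactorsThrough f torusMk := by
    rintro x y hxy
    obtain ⟨m, n, rfl⟩ := torusMk_eq_iff.1 hxy
    have h1 : Function.Periodic (fun t => f (t, y.2 + n)) 1 := fun t => (hp t _).1
    have h2 : Function.Periodic (fun t => f (y.1, t)) 1 := fun t => (hp _ t).2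
    have h3 := h1.int_mul m y.1
    have h4 := h2.int_mul n y.2
    simp only [mul_one] at h3 h4
    rw [h3, h4]
  refine ⟨isOpenQuotientMap_torusMk.isQuotientMap.lift f hfac, fun x => ?_⟩
  obtain ⟨y, rfl⟩ := isOpenQuotientMap_torusMk.surjective x
  rw [← hf]
  exact congrArg _ (DFunLike.congr_fun
    (isOpenQuotientMap_torusMk.isQuotientMap.lift_comp f hfac) y)

end Periods

/-! ### Ranks of cocycles and coboundaries. -/

lemma finrank_int_range_add_ker {M N : Type*} [AddCommGroup M] [AddCommGroup N] [Module.Finite ℤ M]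
    (f : M →ₗ[ℤ] N) : Module.finrank ℤ (LinearMap.range f) + Module.finrank ℤ (LinearMap.ker f) =
      Module.finrank ℤ M := by
  rw [← f.quotKerEquivRange.finrank_eq]
  exact Submodule.finrank_quotient_add_finrank _

namespace RotationSystem

variable {V : Type} {G : SimpleGraph V} (R : RotationSystem G)

/-- The integral 1-cocycles: antisymmetric functions on the darts whose sum along each facial walk
vanishes. -/
def cocycles : Submodule ℤ (G.Dart → ℤ) where
  carrier := {c | (∀ d, c d.symm = - c d) ∧
    ∀ d, ∑ k ∈ Finset.range (R.faceLength d), c (R.facePerm^[k] d) = 0}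
  zero_mem' := by simp
  add_mem' := fun {a b} ha hb => ⟨fun d => by simp [ha.1 d, hb.1 d]; ring, fun d => by
    simp [Finset.sum_add_distrib, ha.2 d, hb.2 d]⟩
  smul_mem' := fun r a ha => ⟨fun d => by simp [ha.1 d], fun d => by
    simp [← Finset.mul_sum, ha.2 d]⟩

/-- The differences of an integral function on the vertices. -/
def coboundary (G : SimpleGraph V) : (V → ℤ) →ₗ[ℤ] (G.Dart → ℤ) where
  toFun ρ d := ρ d.snd - ρ d.fst
  map_add' ρ ρ' := by ext d; simp; ring
  map_smul' r ρ := by ext d; simp; ring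

/-- The constant functions have zero coboundary, which costs at least one from the rank of `V → ℤ`.
-/
lemma finrank_range_coboundary_lt [Finite V] [Nonempty V] :
    Module.finrank ℤ (LinearMap.range (coboundary G)) + 1 ≤ Nat.card V := by
  have := Fintype.ofFinite V
  have h1 := finrank_int_range_add_ker (coboundary G)
  rw [Module.finrank_fintype_fun_eq_card, ← Nat.card_eq_fintype_card] at h1
  have h2 : 0 < Module.finrank ℤ (LinearMap.ker (coboundary G)) := by
    rw [Module.finrank_pos_iff]
    refine ⟨⟨⟨1, ?_⟩, 0, fun h => ?_⟩⟩
    · rw [LinearMap.mem_ker]; ext d; simp [coboundary]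
    · have := congrFun (congrArg Subtype.val h) (Classical.arbitrary V)
      simp at this
  omega

lemma two_mul_card_edgeSet [Finite V] : Nat.card G.Dart = 2 * Nat.card G.edgeSet := by
  classical
  have := Fintype.ofFinite V
  rw [Nat.card_eq_fintype_card, Nat.card_eq_fintype_card, G.dart_card_eq_twice_card_edges,
    SimpleGraph.edgeFinset_card]

/-- The map `L` takes sums over edges and over facial walks; a function in its kernel is a cocycle.
The edge sums and the face sums have the same total, so the image of `L` lies in the kernel of the
nonzero functional `T` and has rank at most `E + F - 1`. The domain has rank `2E`. -/
lemma card_edgeSet_add_one_le [Finite V] [Nonempty G.Dart] :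
    Nat.card G.edgeSet + 1 ≤ R.numFaces + Module.finrank ℤ R.cocycles := by
  classical
  have := Fintype.ofFinite V
  have : Fintype G.Dart := Fintype.ofFinite _
  let F := Quotient (Equiv.Perm.SameCycle.setoid R.facePerm)
  have : Fintype F := Fintype.ofFinite _
  let mk : G.Dart → F := Quotient.mk _
  let L : (G.Dart → ℤ) →ₗ[ℤ] (G.edgeSet → ℤ) × (F → ℤ) :=
    { toFun := fun c => (fun e => ∑ d with d.edge = e.1, c d, fun q => ∑ d with mk d = q, c d)
      map_add' := fun c c' => by ext <;> simp [Finset.sum_add_distrib]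
      map_smul' := fun r c => by ext <;> simp [Finset.mul_sum] }
  let T : (G.edgeSet → ℤ) × (F → ℤ) →ₗ[ℤ] ℤ :=
    { toFun := fun a => ∑ e, a.1 e - ∑ q, a.2 q
      map_add' := fun c c' => by simp [Finset.sum_add_distrib]; ring
      map_smul' := fun r c => by simp [← Finset.mul_sum]; ring }
  have hLT : LinearMap.range L ≤ LinearMap.ker T := by
    rintro _ ⟨c, rfl⟩
    have h1 : ∑ e : G.edgeSet, ∑ d with d.edge = e.1, c d = ∑ d, c d := by
      have := Finset.sum_fiberwise_of_maps_to (s := (Finset.univ : Finset G.Dart))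
        (t := (Finset.univ : Finset G.edgeSet)) (g := fun d => (⟨d.edge, d.edge_mem⟩ : G.edgeSet))
        (fun _ _ => Finset.mem_univ _) c
      rw [← this]
      refine Finset.sum_congr rfl fun e _ => ?_
      simp only [Subtype.ext_iff]
    have h2 : ∑ q : F, ∑ d with mk d = q, c d = ∑ d, c d :=
      Finset.sum_fiberwise_of_maps_to (fun _ _ => Finset.mem_univ _) c
    change ∑ e : G.edgeSet, ∑ d with d.edge = e.1, c d - ∑ q : F, ∑ d with mk d = q, c d = 0
    rw [h1, h2, sub_self]
  have hker : LinearMap.ker L ≤ R.cocycles := by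
    intro c hc
    have hc1 : ∀ e : G.edgeSet, ∑ d with d.edge = e.1, c d = 0 :=
      fun e => congrFun (congrArg Prod.fst hc) e
    have hc2 : ∀ q : F, ∑ d with mk d = q, c d = 0 := fun q => congrFun (congrArg Prod.snd hc) q
    refine ⟨fun d => ?_, fun d => ?_⟩
    · have h := hc1 ⟨d.edge, d.edge_mem⟩
      have h2 : (Finset.univ.filter fun d' : G.Dart => d'.edge = d.edge) = {d, d.symm} := by
        ext d'
        simp [SimpleGraph.dart_edge_eq_iff]
      rw [h2, Finset.sum_pair d.symm_ne.symm] at h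
      linarith
    · have h := hc2 (mk d)
      have h2 : (Finset.univ.filter fun d' : G.Dart => mk d' = mk d) =
          (Finset.range (R.faceLength d)).image fun k => R.facePerm^[k] d := by
        ext d'
        simp only [Finset.mem_filter, Finset.mem_univ, true_and, Finset.mem_image,
          Finset.mem_range]
        rw [← R.sameCycle_iff_exists_iterate]
        exact ⟨fun h => (Quotient.exact h).symm, fun h => (Quotient.sound h).symm⟩
      rw [h2, Finset.sum_image] at h
      · exact h
      · intro a ha b hb hab
        exact Function.iterate_injOn_Iio_minimalPeriod (Finset.mem_range.1 ha)
          (Finset.mem_range.1 hb) hab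
  have hT : LinearMap.range T = ⊤ := by
    obtain ⟨d⟩ := ‹Nonempty G.Dart›
    rw [LinearMap.range_eq_top]
    intro m
    refine ⟨(fun e => if e = ⟨d.edge, d.edge_mem⟩ then m else 0, 0), ?_⟩
    simp [T]
  have h1 := finrank_int_range_add_ker L
  have h2 := finrank_int_range_add_ker T
  have h3 := Submodule.finrank_mono hLT
  have h4 := Submodule.finrank_mono hker
  rw [hT, finrank_top, Module.finrank_self, Module.finrank_prod, Module.finrank_fintype_fun_eq_card,
    Module.finrank_fintype_fun_eq_card, ← Nat.card_eq_fintype_card, ← Nat.card_eq_fintype_card]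
    at h2
  rw [Module.finrank_fintype_fun_eq_card, ← Nat.card_eq_fintype_card, two_mul_card_edgeSet] at h1
  have h5 : R.numFaces = Nat.card F := rfl
  omega

/-- The partial sums of a function on the darts along the facial walk that starts with `d`. -/
def partialSum (d : G.Dart) (c : G.Dart → ℤ) (k : ℤ) : ℝ :=
  ∑ j ∈ Finset.range (k % R.faceLength d).toNat, (c (R.facePerm^[j] d) : ℝ)

lemma partialSum_add_faceLength (d : G.Dart) (c : G.Dart → ℤ) (k : ℤ) :
    R.partialSum d c (k + R.faceLength d) = R.partialSum d c k := by
  simp [partialSum]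

/-- Reducing the index modulo the length of the walk is harmless for a cocycle, since its sum over
the whole walk is zero. -/
lemma partialSum_natCast {c : G.Dart → ℤ} (hc : c ∈ R.cocycles) (d : G.Dart) (k : ℕ) :
    R.partialSum d c k = ((∑ j ∈ Finset.range k, c (R.facePerm^[j] d) : ℤ) : ℝ) := by
  have hper : Function.Periodic (fun k => ∑ j ∈ Finset.range k, c (R.facePerm^[j] d))
      (R.faceLength d) := fun k => by
    change ∑ j ∈ Finset.range (k + R.faceLength d), _ = _
    rw [add_comm, Finset.sum_range_add, hc.2 d, zero_add]
    refine Finset.sum_congr rfl fun j _ => ?_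
    rw [add_comm, facePerm_iterate_add_faceLength]
  rw [← hper.map_mod_nat k, partialSum, ← Int.natCast_mod, Int.toNat_natCast]
  push_cast
  rfl

lemma partialSum_add (d : G.Dart) (c c' : G.Dart → ℤ) (k : ℤ) :
    R.partialSum d (c + c') k = R.partialSum d c k + R.partialSum d c' k := by
  simp [partialSum, Finset.sum_add_distrib]

/-- The radial extension to the disc of the partial sums along a facial walk. -/
def cellFunction (d : G.Dart) (c : G.Dart → ℤ) (z : ℂ) : ℝ :=
  cone (R.faceLength d) (piecewiseAffine (R.partialSum d c)) z

lemma cellFunction_add (d : G.Dart) (c c' : G.Dart → ℤ) (z : ℂ) :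
    R.cellFunction d (c + c') z = R.cellFunction d c z + R.cellFunction d c' z := by
  simp only [cellFunction, cone, piecewiseAffine, partialSum_add, smul_eq_mul]
  ring

lemma piecewiseAffine_partialSum_periodic (d : G.Dart) (c : G.Dart → ℤ) :
    Function.Periodic (piecewiseAffine (R.partialSum d c)) (R.faceLength d) :=
  piecewiseAffine_periodic (R.partialSum_add_faceLength d c)

lemma continuous_cellFunction (d : G.Dart) (c : G.Dart → ℤ) : Continuous (R.cellFunction d c) :=
  continuous_cone (continuous_piecewiseAffine _) (R.piecewiseAffine_partialSum_periodic d c)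

/-- Modulo 1 the integral partial sum before arc `k` vanishes. What is left depends only on the dart
and not on the cell, so the cell functions can be glued. -/
lemma coe_cellFunction_exp [Finite V] {c : G.Dart → ℤ} (hc : c ∈ R.cocycles) (d : G.Dart) (k : ℕ)
    (s : I) : (R.cellFunction d c (Complex.exp (2 * Real.pi * Complex.I *
      (((k : ℂ) + ((s : ℝ) : ℂ)) / (R.faceLength d : ℂ)))) : UnitAddCircle) =
      ((s * c (R.facePerm^[k] d) : ℝ) : UnitAddCircle) := by
  have h := cone_smul_exp (R.faceLength_pos d) (R.piecewiseAffine_partialSum_periodic d c)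
    zero_le_one (k + s)
  simp only [Complex.ofReal_one, one_mul, one_smul, Complex.ofReal_add, Complex.ofReal_natCast] at h
  rw [cellFunction, h]
  have h1 := piecewiseAffine_add (R.partialSum d c) k s.2.1 s.2.2
  have h2 := R.partialSum_natCast hc d k
  have h3 := R.partialSum_natCast hc d (k + 1)
  simp only [Nat.cast_add, Nat.cast_one, Int.cast_natCast] at h1 h2 h3
  rw [h1, h2, h3, unitAddCircle_coe_eq_coe_iff]
  refine ⟨∑ j ∈ Finset.range k, c (R.facePerm^[j] d), ?_⟩
  rw [Finset.sum_range_succ]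
  push_cast
  simp only [smul_eq_mul]
  ring

end RotationSystem

/-! ### The Euler characteristic of 2-cell embeddings in the torus. -/

namespace TorusEmbedding

variable {V : Type} {G : SimpleGraph V} {e : TorusEmbedding G} {R : RotationSystem G}

namespace CellData

/-- All vertices go to 0 and the arc of `d` winds `c d` times round the circle; antisymmetry of `c`
makes the two directions of an edge agree. -/
lemma exists_circleMap [Finite V] (C : CellData e R) (hV : ∀ v, ∃ d : G.Dart, d.fst = v)
    (c : R.cocycles) : ∃ u : C(Torus, UnitAddCircle),
      (∀ q : Quotient (Equiv.Perm.SameCycle.setoid R.facePerm), ∀ z ∈ Metric.closedBall (0 : ℂ) 1,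
        u (C.cell q.out z) = R.cellFunction q.out c z) ∧
      ∀ (d : G.Dart) (s : I), u (e.arc d s) = ((s * c.1 d : ℝ) : UnitAddCircle) := by
  obtain ⟨u, hu⟩ := C.exists_glue hV (Y := UnitAddCircle) (v := fun _ => 0)
    (A := fun d s => ((s * c.1 d : ℝ) : UnitAddCircle)) (g := fun d z => R.cellFunction d c z)
    (fun d => by simp) (fun d t => by
      rw [unitAddCircle_coe_eq_coe_iff]
      refine ⟨- c.1 d, ?_⟩
      rw [c.2.1 d, unitInterval.coe_symm_eq]
      push_cast
      ring)
    (fun d => ((AddCircle.continuous_mk' 1).comp (R.continuous_cellFunction d c)).continuousOn)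
    (fun d k s => R.coe_cellFunction_exp c.2 d k s)
  exact ⟨u, hu, C.glue_arc (A := fun d s => ((s * c.1 d : ℝ) : UnitAddCircle))
    (g := fun d z => R.cellFunction d c z)
    (fun d k s => R.coe_cellFunction_exp c.2 d k s) hu⟩

/-- The circle-valued function on the torus that represents a cocycle. -/
def circleMap [Finite V] (C : CellData e R) (hV : ∀ v, ∃ d : G.Dart, d.fst = v) :
    R.cocycles →+ C(Torus, UnitAddCircle) :=
  AddMonoidHom.mk' (fun c => (C.exists_circleMap hV c).choose) fun c c' => by
    ext x
    obtain ⟨q, z, hz, rfl⟩ := C.exists_cell_eq hV x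
    rw [ContinuousMap.add_apply, (C.exists_circleMap hV (c + c')).choose_spec.1 q z hz,
      (C.exists_circleMap hV c).choose_spec.1 q z hz,
      (C.exists_circleMap hV c').choose_spec.1 q z hz, ← AddCircle.coe_add,
      ← R.cellFunction_add]
    rfl

lemma circleMap_arc [Finite V] (C : CellData e R) (hV : ∀ v, ∃ d : G.Dart, d.fst = v)
    (c : R.cocycles) (d : G.Dart) (s : I) :
    C.circleMap hV c (e.arc d s) = ((s * c.1 d : ℝ) : UnitAddCircle) :=
  (C.exists_circleMap hV c).choose_spec.2 d s

/-- Without periods there is a real-valued lift. It is integral at the vertices and increases by `c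
d` along the arc of `d`, so its values at the vertices have coboundary `c`. -/
lemma mem_range_coboundary [Finite V] (C : CellData e R) (hV : ∀ v, ∃ d : G.Dart, d.fst = v)
    {c : R.cocycles} (h : torusPeriods (C.circleMap hV c) = 0) :
    c.1 ∈ LinearMap.range (RotationSystem.coboundary G) := by
  obtain ⟨r, hr⟩ := exists_lift_of_torusPeriods_eq_zero h
  have hv : ∀ v, (r (e.pt v) : UnitAddCircle) = 0 := fun v => by
    obtain ⟨d, rfl⟩ := hV v
    rw [hr, ← e.arc_zero, C.circleMap_arc]
    simp
  choose ρ hρ using fun v => unitAddCircle_coe_eq_zero_iff.1 (hv v)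
  refine ⟨ρ, funext fun d => ?_⟩
  obtain ⟨m, hm⟩ := exists_int_of_coe_eq_zero (f := fun s : I => r (e.arc d s) - s * c.1 d)
    (by fun_prop) (fun s => by rw [AddCircle.coe_sub, hr, C.circleMap_arc, sub_self])
  have h0 := hm 0
  have h1 := hm 1
  rw [e.arc_zero, hρ] at h0
  rw [e.arc_one, hρ] at h1
  simp only [Set.Icc.coe_zero, Set.Icc.coe_one, zero_mul, one_mul, sub_zero] at h0 h1
  have : (ρ d.snd - ρ d.fst : ℝ) = c.1 d := by linarith
  exact_mod_cast this

end CellData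

/-- The Euler characteristic of a 2-cell embedding in the torus is not negative. -/
theorem IsTwoCellWith.eulerChar_nonneg [Finite V] [Nonempty V]
    (hV : ∀ v, ∃ d : G.Dart, d.fst = v) (h : e.IsTwoCellWith R) : 0 ≤ R.eulerChar := by
  obtain ⟨C⟩ := h.nonempty_cellData
  have : Nonempty G.Dart := ⟨(hV (Classical.arbitrary V)).choose⟩
  have := Fintype.ofFinite G.Dart
  -- The image of `P` has rank at most 2 and its kernel consists of coboundaries, so `E + 1 - F ≤
  -- rank ≤ 2 + (V - 1)`.
  let P : R.cocycles →ₗ[ℤ] ℤ × ℤ := (torusPeriods.comp (C.circleMap hV)).toIntLinearMap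
  have h1 := finrank_int_range_add_ker P
  have h2 : Module.finrank ℤ (LinearMap.range P) ≤ 2 := by
    refine (Submodule.finrank_le _).trans ?_
    rw [Module.finrank_prod, Module.finrank_self]
  have h3 : (LinearMap.ker P).map R.cocycles.subtype ≤
      LinearMap.range (RotationSystem.coboundary G) := by
    rintro _ ⟨c, hc, rfl⟩
    exact C.mem_range_coboundary hV hc
  have h4 := Submodule.finrank_mono h3
  rw [Submodule.finrank_map_subtype_eq] at h4
  have h5 := RotationSystem.finrank_range_coboundary_lt (G := G)
  have h6 := R.card_edgeSet_add_one_le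
  rw [RotationSystem.eulerChar]
  omega

end TorusEmbedding

lemma RotationSystem.ext_rot {V : Type} {G : SimpleGraph V} {R R' : RotationSystem G}
    (h : ∀ d, R.rot d = R'.rot d) : R = R' := by
  cases R
  cases R'
  congr 1
  exact Equiv.ext h

/-! ### Rotation systems of the graph with triangular faces. -/

namespace Gamma37

/-- The differences of adjacent vertices of `Gamma37`: the sixth roots of unity in `ZMod 37`. -/
def steps : Finset (ZMod 37) := {1, 11, 10, -1, -11, -10}

lemma adj_iff {x y : ZMod 37} : Gamma37.Adj x y ↔ y - x ∈ steps := by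
  rw [Gamma37, SimpleGraph.addCayley_adj']
  constructor
  · rintro ⟨-, g, hg, h⟩
    rcases hg with rfl | rfl | rfl <;> rcases h with rfl | rfl <;> simp [steps]
  · intro h
    refine ⟨?_, ?_⟩
    · rintro rfl
      rw [sub_self] at h
      revert h
      decide
    · simp only [steps, Finset.mem_insert, Finset.mem_singleton] at h
      rcases h with h | h | h | h | h | h
      · exact ⟨1, by simp, Or.inl (by rw [← h]; ring)⟩
      · exact ⟨11, by simp, Or.inl (by rw [← h]; ring)⟩
      · exact ⟨10, by simp, Or.inl (by rw [← h]; ring)⟩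
      · exact ⟨1, by simp, Or.inr (by linear_combination -h)⟩
      · exact ⟨11, by simp, Or.inr (by linear_combination -h)⟩
      · exact ⟨10, by simp, Or.inr (by linear_combination -h)⟩

/-- The dart from `x` to `x + s`. -/
def dart (x s : ZMod 37) (hs : s ∈ steps) : Gamma37.Dart :=
  ⟨(x, x + s), adj_iff.2 (by simpa using hs)⟩

/-- The difference of the end vertices of a dart. -/
def step (d : Gamma37.Dart) : ZMod 37 := d.snd - d.fst

lemma step_mem (d : Gamma37.Dart) : step d ∈ steps := adj_iff.1 d.adj

@[simp] lemma dart_fst (x s : ZMod 37) (hs : s ∈ steps) : (dart x s hs).fst = x := rfl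

@[simp] lemma step_dart (x s : ZMod 37) (hs : s ∈ steps) : step (dart x s hs) = s := by
  simp [step, dart]

lemma snd_eq (d : Gamma37.Dart) : d.snd = d.fst + step d := by simp [step]

@[simp] lemma step_symm (d : Gamma37.Dart) : step d.symm = - step d := by
  change d.fst - d.snd = -(d.snd - d.fst)
  ring

lemma dart_ext {d d' : Gamma37.Dart} (h : d.fst = d'.fst) (h' : step d = step d') : d = d' :=
  SimpleGraph.Dart.ext _ _ (Prod.ext h (by
    rw [snd_eq, snd_eq, h, h']))

lemma thirty_seven_eq_zero : (37 : ZMod 37) = 0 := rfl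

lemma mul_mem_steps : ∀ s ∈ steps, 11 * s ∈ steps := by decide

lemma inv_mul_mem_steps : ∀ s ∈ steps, 27 * s ∈ steps := by decide

lemma neg_mem_steps : ∀ s ∈ steps, -s ∈ steps := by decide

/-- The rotation system of `Gamma37` in which the rotation at each vertex is multiplication of the
steps by `11`. -/
def rotationSystem : RotationSystem Gamma37 where
  rot :=
    { toFun := fun d => dart d.fst (11 * step d) (mul_mem_steps _ (step_mem d))
      invFun := fun d => dart d.fst (27 * step d) (inv_mul_mem_steps _ (step_mem d))
      left_inv := fun d => dart_ext rfl (by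
        rw [step_dart, step_dart, ← mul_assoc, show (27 * 11 : ZMod 37) = 1 from rfl, one_mul])
      right_inv := fun d => dart_ext rfl (by
        rw [step_dart, step_dart, ← mul_assoc, show (11 * 27 : ZMod 37) = 1 from rfl, one_mul]) }
  rot_fst d := rfl
  sameCycle d d' h := by
    -- 11 generates the group of sixth roots of unity modulo 37, so its powers reach every dart at
    -- the vertex.
    have key : ∀ s ∈ steps, ∀ t ∈ steps, ∃ k : Fin 6, t = 11 ^ (k : ℕ) * s := by decide
    obtain ⟨k, hk⟩ := key _ (step_mem d) _ (step_mem d')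
    refine ⟨(k : ℕ), ?_⟩
    rw [zpow_natCast, ← Equiv.Perm.iterate_eq_pow]
    have hit : ∀ k : ℕ, (((fun d : Gamma37.Dart => dart d.fst (11 * step d)
        (mul_mem_steps _ (step_mem d)))^[k]) d).fst = d.fst ∧
        step (((fun d : Gamma37.Dart => dart d.fst (11 * step d)
          (mul_mem_steps _ (step_mem d)))^[k]) d) = 11 ^ k * step d := by
      intro k
      induction k with
      | zero => simp
      | succ k ih =>
        rw [Function.iterate_succ_apply']
        refine ⟨ih.1, ?_⟩
        rw [step_dart, ih.2]
        ring
    exact dart_ext ((hit k).1.trans h) ((hit k).2.trans hk.symm)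

@[simp] lemma step_rot (d : Gamma37.Dart) : step (rotationSystem.rot d) = 11 * step d :=
  step_dart _ _ (mul_mem_steps _ (step_mem d))

lemma step_rot_mirror (d : Gamma37.Dart) :
    step (rotationSystem.mirror.rot d) = 27 * step d :=
  step_dart _ _ (inv_mul_mem_steps _ (step_mem d))

@[simp] lemma step_facePerm (d : Gamma37.Dart) :
    step (rotationSystem.facePerm d) = -11 * step d := by
  rw [RotationSystem.facePerm_apply, step_rot, step_symm]
  ring

/-- `-11` is a primitive cube root of unity modulo 37: `1 - 11 + 121 = 3 · 37` closes the walk, and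
`(-11)³ = 1 - 36 · 37` restores the step. -/
lemma facePerm_facePerm_facePerm (d : Gamma37.Dart) :
    rotationSystem.facePerm (rotationSystem.facePerm (rotationSystem.facePerm d)) = d := by
  refine dart_ext ?_ ?_
  · simp only [RotationSystem.facePerm_fst, snd_eq, step_facePerm]
    linear_combination (3 * step d) * thirty_seven_eq_zero
  · simp only [step_facePerm]
    linear_combination (-36 * step d) * thirty_seven_eq_zero

/-- Darts are determined by their initial vertex and step. -/
def dartEquiv : Gamma37.Dart ≃ ZMod 37 × steps where
  toFun d := (d.fst, ⟨step d, step_mem d⟩)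
  invFun p := dart p.1 p.2.1 p.2.2
  left_inv _ := dart_ext rfl (step_dart _ _ _)
  right_inv _ := Prod.ext rfl (Subtype.ext (step_dart _ _ _))

lemma card_dart : Nat.card Gamma37.Dart = 222 := by
  rw [Nat.card_congr dartEquiv, Nat.card_prod, Nat.card_zmod, Nat.card_eq_fintype_card,
    Fintype.card_coe]
  rfl

lemma card_edgeSet : Nat.card Gamma37.edgeSet = 111 := by
  have h := RotationSystem.two_mul_card_edgeSet (G := Gamma37)
  rw [card_dart] at h
  omega

lemma exists_dart_fst (v : ZMod 37) : ∃ d : Gamma37.Dart, d.fst = v :=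
  ⟨dart v 1 (by decide), rfl⟩

variable (R : RotationSystem Gamma37)

lemma rot_ne (d : Gamma37.Dart) : R.rot d ≠ d := by
  refine R.rot_ne (d' := dart d.fst (-step d) (neg_mem_steps _ (step_mem d))) rfl fun h => ?_
  have h1 := congrArg step h
  rw [step_dart] at h1
  have key : ∀ s ∈ steps, s ≠ -s := by decide
  exact key _ (step_mem d) h1

lemma eulerChar_eq : R.eulerChar = R.numFaces - 74 := by
  rw [RotationSystem.eulerChar, card_edgeSet, Nat.card_zmod]
  push_cast
  ring

theorem eulerChar_nonpos : R.eulerChar ≤ 0 := by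
  have h := three_mul_card_sameCycle_le R.facePerm_ne (R.facePerm_facePerm_ne (rot_ne R))
  rw [card_dart] at h
  have h1 : R.numFaces = Nat.card (Quotient (Equiv.Perm.SameCycle.setoid R.facePerm)) := rfl
  rw [eulerChar_eq]
  omega

lemma facePerm_facePerm_facePerm_of_eulerChar_nonneg (h : 0 ≤ R.eulerChar) (d : Gamma37.Dart) :
    R.facePerm (R.facePerm (R.facePerm d)) = d := by
  refine apply_apply_apply_eq_of_card_le R.facePerm_ne (R.facePerm_facePerm_ne (rot_ne R)) ?_ d
  have h1 : R.numFaces = Nat.card (Quotient (Equiv.Perm.SameCycle.setoid R.facePerm)) := rfl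
  rw [eulerChar_eq] at h
  rw [card_dart]
  omega

/-- The graph is connected: its edges of step 1 already form a cycle through all vertices. -/
lemma adj_induction {p : ZMod 37 → Prop} (h : ∀ x y, Gamma37.Adj x y → p x → p y) {x : ZMod 37}
    (hx : p x) (y : ZMod 37) : p y := by
  have key : ∀ n : ℕ, p (x + n) := by
    intro n
    induction n with
    | zero => simpa using hx
    | succ n ih =>
      refine h _ _ (adj_iff.2 ?_) ih
      push_cast
      rw [← add_assoc, add_sub_cancel_left]
      decide
  have h1 := key (y - x).val
  rwa [ZMod.natCast_val, ZMod.cast_id', id, add_sub_cancel] at h1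

/-- The rotation systems all of whose facial walks are triangles are unique up to reversal. -/
theorem eq_rotationSystem_or_eq_mirror
    (h : ∀ d, R.facePerm (R.facePerm (R.facePerm d)) = d) :
    R = rotationSystem ∨ R = rotationSystem.mirror := by
  -- The steps round a triangle sum to zero, and two steps whose negated sum is again a step have as
  -- ratio a primitive cube root of unity, `-11` or `-27`.
  have hrot : ∀ d, step (R.rot d) = 11 * step d ∨ step (R.rot d) = 27 * step d := by
    intro d
    set d₁ := d.symm with hd₁
    have hs : step d₁ + step (R.facePerm d₁) + step (R.facePerm (R.facePerm d₁)) = 0 := by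
      have h1 : (R.facePerm (R.facePerm (R.facePerm d₁))).fst = d₁.fst := by rw [h]
      simp only [RotationSystem.facePerm_fst, snd_eq] at h1
      linear_combination h1
    have key : ∀ s ∈ steps, ∀ t ∈ steps, -(s + t) ∈ steps →
        t = 11 * (-s) ∨ t = 27 * (-s) := by decide
    have h2 := key _ (step_mem _) _ (step_mem _)
      (by rw [neg_eq_of_add_eq_zero_right hs]; exact step_mem _)
    rw [RotationSystem.rot_eq_facePerm, ← hd₁]
    simpa [hd₁] using h2
  -- A turn by 11 followed by one by 27 would return to `d`, and the rotation would cycle through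
  -- two darts instead of six.
  have hpos : ∀ d, step (R.rot d) = 11 * step d → step (R.rot (R.rot d)) = 11 * step (R.rot d) := by
    intro d hd
    refine (hrot _).resolve_right fun h2 => ?_
    have h3 : R.rot (R.rot d) = d := by
      refine dart_ext (by simp only [R.rot_fst]) ?_
      rw [h2, hd, ← mul_assoc, show (27 * 11 : ZMod 37) = 1 from rfl, one_mul]
    have h4 : ∀ d', d'.fst = d.fst → d' = d ∨ d' = R.rot d := by
      intro d' hd'
      obtain ⟨k, -, hk⟩ := (R.sameCycle d d' hd'.symm).exists_pow_eq'
      rw [← hk]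
      clear hk
      induction k with
      | zero => exact Or.inl rfl
      | succ k ih =>
        rw [pow_succ', Equiv.Perm.mul_apply]
        rcases ih with ih | ih <;> rw [ih]
        · exact Or.inr rfl
        · exact Or.inl h3
    have h5 : ∀ s ∈ steps, s = step d ∨ s = 11 * step d := by
      intro s hs
      rcases h4 (dart d.fst s hs) rfl with h | h
      · left; rw [← h, step_dart]
      · right; rw [← hd, ← h, step_dart]
    have key : ∀ t ∈ steps, ¬ ∀ s ∈ steps, s = t ∨ s = 11 * t := by decide
    exact key _ (step_mem d) h5
  have hvert : ∀ d d', d.fst = d'.fst → step (R.rot d) = 11 * step d →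
      step (R.rot d') = 11 * step d' := by
    intro d d' hdd hd
    obtain ⟨k, -, hk⟩ := (R.sameCycle d d' hdd).exists_pow_eq'
    rw [← hk]
    clear hk
    induction k with
    | zero => exact hd
    | succ k ih =>
      rw [pow_succ', Equiv.Perm.mul_apply]
      exact hpos _ ih
  by_cases hex : ∃ d, step (R.rot d) = 11 * step d
  · left
    obtain ⟨d₀, hd₀⟩ := hex
    have hall : ∀ v d, d.fst = v → step (R.rot d) = 11 * step d := by
      refine adj_induction (x := d₀.fst) (fun x y hxy hx d hd => ?_)
        fun d hd => hvert _ _ hd.symm hd₀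
      -- The dart `a` precedes `x → y` in its triangle. The turn at `x` is by 11, and the zero sum
      -- of the three steps then makes the turn at `y` by 11 too.
      let a : Gamma37.Dart := R.facePerm.symm ⟨(x, y), hxy⟩
      have ha : R.facePerm a = ⟨(x, y), hxy⟩ := R.facePerm.apply_symm_apply _
      have has : a.snd = x := by rw [← R.facePerm_fst, ha]
      have h1 : step (R.facePerm a) = 11 * step a.symm := hx a.symm has
      have h2 : R.facePerm (R.facePerm a) = R.rot (R.facePerm a).symm := rfl
      refine hvert (R.facePerm a).symm d ?_ ?_
      · rw [hd, ha]; rfl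
      · rw [← h2]
        have hs : step a + step (R.facePerm a) + step (R.facePerm (R.facePerm a)) = 0 := by
          have h1 : (R.facePerm (R.facePerm (R.facePerm a))).fst = a.fst := by rw [h]
          simp only [RotationSystem.facePerm_fst, snd_eq] at h1
          linear_combination h1
        rw [step_symm] at h1 ⊢
        linear_combination hs + 10 * h1 + (- 3 * step a) * thirty_seven_eq_zero
    exact RotationSystem.ext_rot fun d => dart_ext (R.rot_fst d) ((hall _ d rfl).trans (step_rot d).symm)
  · right
    push Not at hex
    exact RotationSystem.ext_rot fun d => dart_ext (R.rot_fst d)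
      (((hrot d).resolve_left (hex d)).trans (step_rot_mirror d).symm)

variable {e : TorusEmbedding Gamma37}

/-- The bound on the Euler characteristic makes all faces triangles; if the rotation system is the
mirror image, the same embedding also has the reversed one. -/
theorem isTwoCellWith_rotationSystem (h : e.IsTwoCell) : e.IsTwoCellWith rotationSystem := by
  obtain ⟨R, hR⟩ := h
  have h3 := facePerm_facePerm_facePerm_of_eulerChar_nonneg R
    (hR.eulerChar_nonneg exists_dart_fst)
  rcases eq_rotationSystem_or_eq_mirror R h3 with rfl | rfl
  · exact hR
  · simpa [RotationSystem.mirror_mirror] using hR.mirror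

lemma faceLength_eq_three (d : Gamma37.Dart) : rotationSystem.faceLength d = 3 :=
  rotationSystem.faceLength_eq_three facePerm_facePerm_facePerm d

lemma step_facePerm_iterate (d : Gamma37.Dart) (k : ℕ) :
    step (rotationSystem.facePerm^[k] d) = (-11) ^ k * step d := by
  induction k with
  | zero => simp
  | succ k ih =>
    rw [Function.iterate_succ_apply', step_facePerm, ih]
    ring

lemma eq_of_facePerm_iterate_fst_eq {d : Gamma37.Dart} {j k : ℕ} (hj : j < 3) (hk : k < 3)
    (h : (rotationSystem.facePerm^[j] d).fst = (rotationSystem.facePerm^[k] d).fst) : j = k := by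
  have key : ∀ s ∈ steps, s ≠ 0 ∧ s + -11 * s ≠ 0 ∧ -11 * s ≠ 0 := by decide
  obtain ⟨h1, h2, h3⟩ := key _ (step_mem d)
  interval_cases j <;> interval_cases k <;>
    simp only [Function.iterate_succ, Function.iterate_zero, Function.comp_apply, id,
      RotationSystem.facePerm_fst, snd_eq, step_facePerm, add_assoc, add_eq_left,
      left_eq_add, add_right_inj, h1, h2, h3] at h ⊢

lemma facePerm_iterate_edge_ne {d : Gamma37.Dart} {j k : ℕ} (hj : j < 3) (hk : k < 3)
    (h : j ≠ k) : (rotationSystem.facePerm^[j] d).edge ≠ (rotationSystem.facePerm^[k] d).edge := by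
  intro he
  rcases (SimpleGraph.dart_edge_eq_iff _ _).1 he with he | he
  · exact h (eq_of_facePerm_iterate_fst_eq hj hk (by rw [he]))
  · have key : ∀ s ∈ steps, ∀ j k : Fin 3, j ≠ k →
        (-11) ^ (j : ℕ) * s ≠ - ((-11) ^ (k : ℕ) * s) := by decide
    refine key _ (step_mem d) ⟨j, hj⟩ ⟨k, hk⟩ (fun h' => h (congrArg Fin.val h')) ?_
    rw [← step_facePerm_iterate, ← step_facePerm_iterate, ← step_symm, he]

/-- Every face of a 2-cell embedding is bounded by a triangle. -/
theorem isTriangulation (h : e.IsTwoCellWith rotationSystem) : e.IsTriangulation := by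
  intro U hU
  obtain ⟨C⟩ := h.nonempty_cellData
  obtain ⟨d, rfl⟩ := C.exists_region_eq U hU
  have hb := fun k s => C.boundary d k s
  have hsph : ∀ z ∈ Metric.sphere (0 : ℂ) 1, ∃ k : ℕ, k < 3 ∧ ∃ s : I, s ≠ 1 ∧
      z = Complex.exp (2 * Real.pi * Complex.I * (((k : ℂ) + ((s : ℝ) : ℂ)) /
        (rotationSystem.faceLength d : ℂ))) ∧
      C.cell d z = e.arc (rotationSystem.facePerm^[k] d) s := fun z hz => by
    have := C.exists_cell_eq_arc d hz
    rwa [faceLength_eq_three] at this ⊢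
  set d₁ := rotationSystem.facePerm d with hd₁
  set d₂ := rotationSystem.facePerm d₁ with hd₂
  have h0 : d₁.fst = d.snd := rotationSystem.facePerm_fst d
  have h1 : d₂.fst = d₁.snd := rotationSystem.facePerm_fst d₁
  have h2 : d.fst = d₂.snd := by
    rw [← rotationSystem.facePerm_fst d₂, hd₂, hd₁, facePerm_facePerm_facePerm]
  have e1 : d₁ = ⟨(d.snd, d₁.snd), h0 ▸ d₁.adj⟩ :=
    SimpleGraph.Dart.ext _ _ (Prod.ext h0 rfl)
  have e2 : d₂ = ⟨(d₁.snd, d.fst), h2 ▸ h1 ▸ d₂.adj⟩ :=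
    SimpleGraph.Dart.ext _ _ (Prod.ext h1 h2.symm)
  refine ⟨d.fst, d.snd, d₁.snd, d.adj, h0 ▸ d₁.adj, h2 ▸ h1 ▸ d₂.adj, C.cell d, C.continuousOn d,
    ?_, (C.bijOn d).image_eq, ?_⟩
  · intro z hz z' hz' hzz
    rw [← Metric.ball_union_sphere] at hz hz'
    rcases hz with hz | hz <;> rcases hz' with hz' | hz'
    · exact (C.bijOn d).injOn hz hz' hzz
    · obtain ⟨k, -, s, -, -, hs⟩ := hsph z' hz'
      exact (C.cell_notMem_support hz (by rw [hzz, hs]; exact e.arc_mem_support _ _)).elim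
    · obtain ⟨k, -, s, -, -, hs⟩ := hsph z hz
      exact (C.cell_notMem_support hz' (by rw [← hzz, hs]; exact e.arc_mem_support _ _)).elim
    · obtain ⟨k, hk, s, hs1, rfl, hs⟩ := hsph z hz
      obtain ⟨k', hk', s', hs1', rfl, hs'⟩ := hsph z' hz'
      rw [hs, hs'] at hzz
      by_cases hkk : k = k'
      · subst hkk
        rw [e.arc_injective _ hzz]
      -- Different sides meet only in ends. As `s, s' ≠ 1`, the points are the initial corners of
      -- two different sides, and these are distinct.
      · obtain ⟨h3, h4⟩ := e.arc_disjoint _ _ s s' (facePerm_iterate_edge_ne hk hk' hkk) hzz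
        rw [h3.resolve_right hs1, h4.resolve_right hs1', e.arc_zero, e.arc_zero,
          e.pt_injective.eq_iff] at hzz
        exact (hkk (eq_of_facePerm_iterate_fst_eq hk hk' hzz)).elim
  · rw [← e1, ← e2]
    ext x
    constructor
    · rintro ⟨z, hz, rfl⟩
      obtain ⟨k, hk, s, -, -, hs⟩ := hsph z hz
      rw [hs]
      interval_cases k
      · exact Or.inl (Or.inl ⟨s, rfl⟩)
      · exact Or.inl (Or.inr ⟨s, rfl⟩)
      · exact Or.inr ⟨s, rfl⟩
    · rintro ((⟨s, rfl⟩ | ⟨s, rfl⟩) | ⟨s, rfl⟩)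
      · exact ⟨_, TorusEmbedding.exp_mem_sphere _ 0 s, hb 0 s⟩
      · exact ⟨_, TorusEmbedding.exp_mem_sphere _ 1 s, hb 1 s⟩
      · exact ⟨_, TorusEmbedding.exp_mem_sphere _ 2 s, hb 2 s⟩

lemma neighborSet_ncard (v : ZMod 37) : (Gamma37.neighborSet v).ncard = 6 := by
  have h : Gamma37.neighborSet v = (fun s => v + s) '' (steps : Set (ZMod 37)) := by
    ext w
    rw [SimpleGraph.mem_neighborSet, adj_iff]
    exact ⟨fun h => ⟨w - v, h, by simp⟩, by rintro ⟨s, hs, rfl⟩; simpa using hs⟩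
  rw [h, Set.ncard_image_of_injective _ (add_right_injective v), Set.ncard_coe_finset]
  rfl

theorem isEulerianTriangulation (h : e.IsTwoCell) : e.IsEulerianTriangulation :=
  ⟨isTriangulation (isTwoCellWith_rotationSystem h), fun v => ⟨Set.toFinite _, by
    rw [neighborSet_ncard]; decide⟩⟩

theorem equivalent {e' : TorusEmbedding Gamma37} (h : e.IsTwoCell) (h' : e'.IsTwoCell) :
    e.Equivalent e' :=
  (isTwoCellWith_rotationSystem h).equivalent exists_dart_fst (isTwoCellWith_rotationSystem h')

end Gamma37

/-! ### A map from the disc to the standard triangle. -/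

section Triangle

/-- The open standard triangle. -/
def openTriangle : Set (ℝ × ℝ) := {p | 0 < p.1 ∧ 0 < p.2 ∧ p.1 + p.2 < 1}

/-- The corners of the standard triangle, in cyclic order. -/
def corner (k : ℤ) : ℝ × ℝ := if k % 3 = 0 then (0, 0) else if k % 3 = 1 then (1, 0) else (0, 1)

/-- A map from the closed disc to the standard triangle that takes three equal arcs of the circle
affinely to the sides. -/
def discToTriangle (z : ℂ) : ℝ × ℝ :=
  (1 / 3, 1 / 3) + cone 3 (piecewiseAffine fun k => corner k - (1 / 3, 1 / 3)) z

lemma corner_periodic : Function.Periodic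
    (piecewiseAffine fun k => corner k - (1 / 3, 1 / 3)) (3 : ℕ) :=
  piecewiseAffine_periodic fun k => by simp [corner]

lemma continuous_discToTriangle : Continuous discToTriangle :=
  continuous_const.add (continuous_cone (continuous_piecewiseAffine _) corner_periodic)

lemma discToTriangle_smul_exp (k : ℤ) {r s : ℝ} (hr : 0 ≤ r) (h0 : 0 ≤ s) (h1 : s ≤ 1) :
    discToTriangle (r * Complex.exp (2 * Real.pi * Complex.I * ((k + s : ℝ) / (3 : ℕ)))) =
      (1 - r) • (1 / 3, 1 / 3) + r • ((1 - s) • corner k + s • corner (k + 1)) := by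
  rw [discToTriangle, cone_smul_exp (by norm_num) corner_periodic hr, piecewiseAffine_add _ _ h0 h1]
  module

lemma corner_zero : corner 0 = (0, 0) := by simp [corner]
lemma corner_one : corner 1 = (1, 0) := by simp [corner]
lemma corner_two : corner 2 = (0, 1) := by simp [corner]
lemma corner_three : corner 3 = (0, 0) := by simp [corner]

/-- The three sectors in coordinates. In sector `k` the smallest barycentric coordinate is the one
that vanishes on side `k`, and it equals `(1 - ‖z‖) / 3`. -/
lemma discToTriangle_cases (z : ℂ) : ∃ k : ℕ, k < 3 ∧ ∃ s : ℝ, 0 ≤ s ∧ s < 1 ∧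
    z = ‖z‖ * Complex.exp (2 * Real.pi * Complex.I * (((k : ℝ) + s : ℝ) / (3 : ℕ))) ∧
    (k = 0 ∧ discToTriangle z = ((1 - ‖z‖) / 3 + ‖z‖ * s, (1 - ‖z‖) / 3) ∨
     k = 1 ∧ discToTriangle z = ((1 - ‖z‖) / 3 + ‖z‖ - ‖z‖ * s, (1 - ‖z‖) / 3 + ‖z‖ * s) ∨
     k = 2 ∧ discToTriangle z = ((1 - ‖z‖) / 3, (1 - ‖z‖) / 3 + ‖z‖ - ‖z‖ * s)) := by
  obtain ⟨k, hk, s, h0, h1, hz⟩ := exists_eq_mul_exp (n := 3) (by norm_num) z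
  refine ⟨k, hk, s, h0, h1, hz, ?_⟩
  have h := discToTriangle_smul_exp k (norm_nonneg z) h0 h1.le
  rw [Int.cast_natCast, ← hz] at h
  rw [h]
  interval_cases k
  · left
    norm_num [corner_zero, corner_one]
    ring
  · right; left
    norm_num [corner_one, corner_two]
    constructor <;> ring
  · right; right
    norm_num [corner_two, corner_three]
    constructor <;> ring

lemma bijOn_discToTriangle : Set.BijOn discToTriangle (Metric.ball 0 1) openTriangle := by
  refine ⟨fun z hz => ?_, fun z hz z' hz' h => ?_, fun p hp => ?_⟩
  · obtain ⟨k, -, s, h0, h1, -, h⟩ := discToTriangle_cases z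
    rw [mem_ball_zero_iff] at hz
    have hn := norm_nonneg z
    have hs0 := mul_nonneg hn h0
    have hs1 := mul_nonneg hn (sub_nonneg.2 h1.le)
    rcases h with ⟨-, h⟩ | ⟨-, h⟩ | ⟨-, h⟩ <;> rw [h] <;> refine ⟨?_, ?_, ?_⟩ <;>
      simp only <;> linarith
  · obtain ⟨k, -, s, h0, h1, hzs, hz1⟩ := discToTriangle_cases z
    obtain ⟨k', -, s', h0', h1', hzs', hz1'⟩ := discToTriangle_cases z'
    have hn := norm_nonneg z
    have hn' := norm_nonneg z'
    rw [h] at hz1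
    have hs0 := mul_nonneg hn h0
    have hs1 := mul_nonneg hn (sub_nonneg.2 h1.le)
    have hs0' := mul_nonneg hn' h0'
    have hs1' := mul_nonneg hn' (sub_nonneg.2 h1'.le)
    by_cases hr : ‖z‖ = 0 ∨ ‖z'‖ = 0
    · have : ‖z‖ = 0 ∧ ‖z'‖ = 0 := by
        rcases hz1 with ⟨-, hz1⟩ | ⟨-, hz1⟩ | ⟨-, hz1⟩ <;>
        rcases hz1' with ⟨-, hz1'⟩ | ⟨-, hz1'⟩ | ⟨-, hz1'⟩ <;>
        rw [hz1, Prod.mk.injEq] at hz1' <;>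
        rcases hr with hr | hr <;> constructor <;> linarith [hz1'.1, hz1'.2]
      rw [norm_eq_zero.1 this.1, norm_eq_zero.1 this.2]
    · push Not at hr
      -- Strictness of `s < 1` separates neighbouring sectors along their common ray.
      have hs2 := mul_pos (hn.lt_of_ne' hr.1) (sub_pos.2 h1)
      have hs2' := mul_pos (hn'.lt_of_ne' hr.2) (sub_pos.2 h1')
      have key : k = k' ∧ ‖z‖ = ‖z'‖ ∧ ‖z‖ * s = ‖z'‖ * s' := by
        rcases hz1 with ⟨rfl, hz1⟩ | ⟨rfl, hz1⟩ | ⟨rfl, hz1⟩ <;>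
        rcases hz1' with ⟨rfl, hz1'⟩ | ⟨rfl, hz1'⟩ | ⟨rfl, hz1'⟩ <;>
        rw [hz1, Prod.mk.injEq] at hz1' <;>
        first
          | (refine ⟨rfl, ?_, ?_⟩ <;> linarith [hz1'.1, hz1'.2])
          | (exfalso; linarith [hz1'.1, hz1'.2])
      obtain ⟨rfl, hr1, hr2⟩ := key
      rw [hr1] at hr2
      rw [hzs, hzs', hr1, mul_left_cancel₀ hr.2 hr2]
  · obtain ⟨α, β⟩ := p
    obtain ⟨hα, hβ, hαβ⟩ := hp
    simp only at hα hβ hαβ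
    have key : ∀ (k : ℤ) (r s : ℝ), 0 ≤ r → r < 1 → 0 ≤ s → s ≤ 1 →
        (1 - r) • ((1 / 3 : ℝ), (1 / 3 : ℝ)) + r • ((1 - s) • corner k + s • corner (k + 1)) =
          (α, β) → (α, β) ∈ discToTriangle '' Metric.ball 0 1 := by
      intro k r s hr hr1 h0 h1 h
      refine ⟨_, ?_, (discToTriangle_smul_exp k hr h0 h1).trans h⟩
      rw [mem_ball_zero_iff, norm_mul, norm_exp_two_pi_mul_div, mul_one, Complex.norm_real,
        Real.norm_of_nonneg hr]
      exact hr1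
    -- The centre is separate because `r = 0` there. Elsewhere the smallest barycentric coordinate
    -- `μ` selects the sector, and `r = 1 - 3μ`.
    by_cases hc : α = 1 / 3 ∧ β = 1 / 3
    · refine key 0 0 0 le_rfl one_pos le_rfl zero_le_one ?_
      rw [hc.1, hc.2]
      simp
    · have hc' : ¬ (α = 1 / 3 ∧ β = 1 / 3) := hc
      by_cases h1 : β ≤ α ∧ β ≤ 1 - α - β
      · have hr : 0 < 1 - 3 * β := by
          refine lt_of_le_of_ne (by linarith) fun h => hc' ⟨by linarith, by linarith⟩
        refine key 0 (1 - 3 * β) ((α - β) / (1 - 3 * β)) hr.le (by linarith)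
          (div_nonneg (by linarith) hr.le) ((div_le_one hr).2 (by linarith)) ?_
        norm_num [corner_zero, corner_one]
        constructor
        · field_simp; ring
        · ring
      · by_cases h2 : 1 - α - β ≤ α ∧ 1 - α - β ≤ β
        · have hr : 0 < 1 - 3 * (1 - α - β) := by
            refine lt_of_le_of_ne (by linarith) fun h => hc' ⟨by linarith, by linarith⟩
          refine key 1 (1 - 3 * (1 - α - β)) ((β - (1 - α - β)) / (1 - 3 * (1 - α - β))) hr.le
            (by linarith) (div_nonneg (by linarith) hr.le) ((div_le_one hr).2 (by linarith)) ?_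
          norm_num [corner_one, corner_two]
          constructor
          · field_simp; ring
          · field_simp; ring
        · have h3 : α ≤ β ∧ α ≤ 1 - α - β := by
            constructor
            · by_contra h
              rcases le_total β (1 - α - β) with h4 | h4
              · exact h1 ⟨by linarith, h4⟩
              · exact h2 ⟨by linarith, h4⟩
            · by_contra h
              rcases le_total β (1 - α - β) with h4 | h4
              · exact h1 ⟨by linarith, h4⟩
              · exact h2 ⟨by linarith, h4⟩
          have hr : 0 < 1 - 3 * α := by
            refine lt_of_le_of_ne (by linarith) fun h => hc' ⟨by linarith, by linarith⟩
          refine key 2 (1 - 3 * α) ((1 - α - β - α) / (1 - 3 * α)) hr.le (by linarith)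
            (div_nonneg (by linarith) hr.le) ((div_le_one hr).2 (by linarith)) ?_
          norm_num [corner_two, corner_three]
          constructor
          · ring
          · field_simp; ring

end Triangle

/-! ### The triangular grid on the torus. -/

namespace Gamma37

section Covering

/-- The projection of the plane, with its triangular lattice, to the torus. -/
def planeMap (x : ℝ × ℝ) : Torus :=
  -- These are coordinates in the basis `(7, 3)`, `(-3, 4)`, of determinant 37.
  torusMk ((4 * x.1 + 3 * x.2) / 37, (-3 * x.1 + 7 * x.2) / 37)

/-- The homomorphism that identifies all vertices. -/
def collapse (p : Torus) : Torus := (7 • p.1 - 3 • p.2, 3 • p.1 + 4 • p.2)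

/-- The positions of the vertices on the torus. -/
def position (k : ZMod 37) : Torus := (ZMod.toAddCircle (4 * k), ZMod.toAddCircle (-3 * k))

lemma continuous_planeMap : Continuous planeMap := by
  unfold planeMap
  fun_prop

lemma torusMk_apply (x : ℝ × ℝ) : torusMk x = ((x.1 : UnitAddCircle), (x.2 : UnitAddCircle)) := rfl

lemma torusMk_add (x y : ℝ × ℝ) : torusMk (x + y) = torusMk x + torusMk y := rfl

lemma planeMap_add (x y : ℝ × ℝ) : planeMap (x + y) = planeMap x + planeMap y := by
  rw [planeMap, planeMap, planeMap, ← torusMk_add]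
  congr 1
  ext <;> simp <;> ring

@[simp] lemma planeMap_zero : planeMap 0 = 0 := by
  have h := planeMap_add 0 0
  rwa [add_zero, left_eq_add] at h

lemma collapse_add (p q : Torus) : collapse (p + q) = collapse p + collapse q := by
  simp only [collapse, Prod.mk_add_mk, Prod.fst_add, Prod.snd_add, smul_add]
  congr 1 <;> abel

lemma collapse_torusMk (x : ℝ × ℝ) :
    collapse (torusMk x) = torusMk (7 * x.1 - 3 * x.2, 3 * x.1 + 4 * x.2) := by
  have h : ∀ (n : ℕ) (t : ℝ), n • (t : UnitAddCircle) = ((n * t : ℝ) : UnitAddCircle) :=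
    fun n t => by rw [← AddCircle.coe_nsmul, nsmul_eq_mul]
  change (7 • (x.1 : UnitAddCircle) - 3 • (x.2 : UnitAddCircle),
    3 • (x.1 : UnitAddCircle) + 4 • (x.2 : UnitAddCircle)) = _
  simp only [h]
  rfl

lemma collapse_planeMap (x : ℝ × ℝ) : collapse (planeMap x) = torusMk x := by
  rw [planeMap, collapse_torusMk]
  congr 1
  ext <;> simp <;> ring

lemma position_add (k l : ZMod 37) : position (k + l) = position k + position l := by
  simp [position, mul_add]

lemma position_injective : Function.Injective position := by
  intro k l h
  have h1 := ZMod.toAddCircle_injective 37 (congrArg Prod.fst h)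
  -- `-9` inverts 4 modulo 37.
  linear_combination (-9) * h1 + (k - l) * thirty_seven_eq_zero

/-- The basis vectors `(7, 3)` and `(-3, 4)` satisfy `m + 10n = 37`, so lattice points modulo their
span are labelled by `ZMod 37`. -/
lemma planeMap_intCast (m n : ℤ) : planeMap ((m : ℝ), (n : ℝ)) = position (m + 10 * n) := by
  have h1 : (4 * (m + 10 * n) : ZMod 37) = ((4 * m + 3 * n : ℤ) : ZMod 37) := by
    push_cast
    linear_combination (n : ZMod 37) * thirty_seven_eq_zero
  have h2 : (-3 * (m + 10 * n) : ZMod 37) = ((-3 * m + 7 * n : ℤ) : ZMod 37) := by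
    push_cast
    linear_combination (- n : ZMod 37) * thirty_seven_eq_zero
  rw [position, h1, h2, ZMod.toAddCircle_intCast, ZMod.toAddCircle_intCast]
  push_cast
  rfl

lemma collapse_position (k : ZMod 37) : collapse (position k) = 0 := by
  obtain ⟨m, rfl⟩ := ZMod.intCast_surjective k
  have h := planeMap_intCast m 0
  simp only [Int.cast_zero, mul_zero, add_zero] at h
  rw [← h, collapse_planeMap]
  exact (torusMk_eq_iff (y := 0)).2 ⟨m, 0, by simp⟩

/-- The fibres of `collapse` are the translates by vertex positions, so a point is given by a vertex
together with lattice coordinates modulo `ℤ²`. -/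
lemma exists_eq_position_add {p : Torus} {x : ℝ × ℝ} (h : collapse p = torusMk x) :
    ∃ k, p = position k + planeMap x := by
  obtain ⟨y, hy⟩ := isOpenQuotientMap_torusMk.surjective p
  rw [← hy, collapse_torusMk] at h
  obtain ⟨m, n, hmn⟩ := torusMk_eq_iff.1 h
  refine ⟨m + 10 * n, ?_⟩
  rw [← planeMap_intCast, ← planeMap_add, ← hy, planeMap]
  obtain ⟨h1, h2⟩ := Prod.mk.inj hmn
  congr 1
  ext
  · simp; linarith
  · simp; linarith

lemma torusMk_eq_of_position_add_eq {k k' : ZMod 37} {x x' : ℝ × ℝ}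
    (h : position k + planeMap x = position k' + planeMap x') : torusMk x = torusMk x' := by
  have h1 := congrArg collapse h
  simpa only [collapse_add, collapse_position, collapse_planeMap, zero_add] using h1

lemma collapse_position_add (k : ZMod 37) (x : ℝ × ℝ) :
    collapse (position k + planeMap x) = torusMk x := by
  rw [collapse_add, collapse_position, zero_add, collapse_planeMap]

end Covering

section Vectors

/-- The coordinates of the steps in the triangular lattice. -/
def coord (s : ZMod 37) : ℤ × ℤ :=
  if s = 1 then (1, 0) else if s = 11 then (1, 1) else if s = 10 then (0, 1) else
  if s = -1 then (-1, 0) else if s = -11 then (-1, -1) else (0, -1)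

/-- The steps as plane vectors. -/
def vec (s : ZMod 37) : ℝ × ℝ := (((coord s).1 : ℝ), ((coord s).2 : ℝ))

lemma vec_neg {s : ZMod 37} (hs : s ∈ steps) : vec (-s) = - vec s := by
  have key : ∀ s ∈ steps, coord (-s) = - coord s := by decide
  simp [vec, key s hs]

lemma planeMap_vec {s : ZMod 37} (hs : s ∈ steps) : planeMap (vec s) = position s := by
  have key : ∀ s ∈ steps, ((coord s).1 : ZMod 37) + 10 * ((coord s).2 : ZMod 37) = s := by decide
  rw [vec, planeMap_intCast, key s hs]

/-- The point at parameter `p` of the triangle to the side of the dart `d`. -/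
def cellPoint (d : Gamma37.Dart) (p : ℝ × ℝ) : Torus :=
  position d.fst + planeMap (p.1 • vec (step d) + p.2 • vec (27 * step d))

lemma coord_facePerm : ∀ s ∈ steps, coord (-11 * s) = coord (27 * s) - coord s ∧
    coord (27 * (-11 * s)) = - coord s := by decide

/-- The next dart of the facial walk spans the same triangle with its corners, and hence the
barycentric coordinates, cyclically shifted. -/
lemma cellPoint_facePerm (d : Gamma37.Dart) (p : ℝ × ℝ) :
    cellPoint (rotationSystem.facePerm d) p = cellPoint d (1 - p.1 - p.2, p.1) := by
  obtain ⟨h1, h2⟩ := coord_facePerm _ (step_mem d)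
  rw [cellPoint, cellPoint, rotationSystem.facePerm_fst, snd_eq, position_add,
    ← planeMap_vec (step_mem d), add_assoc, ← planeMap_add, step_facePerm]
  congr 2
  simp only [vec, h1, h2]
  ext <;> simp <;> ring

end Vectors

section Embedding

lemma eq_zero_or_eq_one_of_int {t : I} {m : ℤ} (h : (t : ℝ) = m) : t = 0 ∨ t = 1 := by
  have h0 := t.2.1
  have h1 := t.2.2
  rw [h] at h0 h1
  have h0' : 0 ≤ m := by exact_mod_cast h0
  have h1' : m ≤ 1 := by exact_mod_cast h1
  obtain rfl | rfl : m = 0 ∨ m = 1 := by omega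
  · left; ext; simpa using h
  · right; ext; simpa using h

/-- The steps are the vectors of norm 1 for the form of the triangular lattice. This gives their
Bézout coefficients and the inverse of `frame`. -/
lemma coord_norm : ∀ s ∈ steps, (coord s).1 * (coord s).1 - (coord s).1 * (coord s).2 +
    (coord s).2 * (coord s).2 = 1 := by decide

lemma coord_unimodular : ∀ s ∈ steps, ∃ m n : ℤ, m * (coord s).1 + n * (coord s).2 = 1 :=
  fun s hs => ⟨(coord s).1 - (coord s).2, (coord s).2, by linear_combination coord_norm s hs⟩

/-- For parallel steps a Bézout combination shows that the difference or the sum of the parameters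
is an integer. For the others the determinant is `±1`, and Cramer's rule makes both parameters
integers. -/
lemma smul_vec_eq_cases {s s' : ZMod 37} (hs : s ∈ steps) (hs' : s' ∈ steps) {t t' : I}
    (h : torusMk ((t : ℝ) • vec s) = torusMk ((t' : ℝ) • vec s')) :
    ((t = 0 ∨ t = 1) ∧ (t' = 0 ∨ t' = 1)) ∨ (s' = s ∧ t' = t) ∨
      (s' = -s ∧ t' = unitInterval.symm t) := by
  obtain ⟨m, n, hmn⟩ := torusMk_eq_iff.1 h
  obtain ⟨h1, h2⟩ := Prod.mk.inj hmn
  simp only [vec, Prod.smul_fst, Prod.smul_snd, smul_eq_mul] at h1 h2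
  have key : ∀ s ∈ steps, ∀ s' ∈ steps, s' = s ∨ s' = -s ∨
      (coord s).1 * (coord s').2 - (coord s).2 * (coord s').1 = 1 ∨
      (coord s).1 * (coord s').2 - (coord s).2 * (coord s').1 = -1 := by decide
  obtain ⟨a, b, hab⟩ := coord_unimodular s hs
  have hab' : (a * (coord s).1 + b * (coord s).2 : ℝ) = 1 := by exact_mod_cast hab
  have z0 : ∀ x : I, (x : ℝ) = 0 → x = 0 := fun x hx => Subtype.ext hx
  have z1 : ∀ x : I, (x : ℝ) = 1 → x = 1 := fun x hx => Subtype.ext hx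
  have h0 := t.2.1
  have h0' := t.2.2
  have h1' := t'.2.1
  have h2' := t'.2.2
  rcases key s hs s' hs' with rfl | rfl | hc
  · have h3 : (t : ℝ) - t' = ((a * m + b * n : ℤ) : ℝ) := by
      push_cast
      linear_combination (- t + t') * hab' + a * h1 + b * h2
    have h4 : -1 ≤ a * m + b * n := by
      have : ((-1 : ℤ) : ℝ) ≤ ((a * m + b * n : ℤ) : ℝ) := by rw [← h3]; push_cast; linarith
      exact_mod_cast this
    have h5 : a * m + b * n ≤ 1 := by
      have : ((a * m + b * n : ℤ) : ℝ) ≤ ((1 : ℤ) : ℝ) := by rw [← h3]; push_cast; linarith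
      exact_mod_cast this
    obtain h6 | h6 | h6 : a * m + b * n = -1 ∨ a * m + b * n = 0 ∨ a * m + b * n = 1 := by omega
    all_goals rw [h6] at h3; push_cast at h3
    · left
      exact ⟨Or.inl (z0 _ (by linarith)), Or.inr (z1 _ (by linarith))⟩
    · right; left
      exact ⟨rfl, by ext; linarith⟩
    · left
      exact ⟨Or.inr (z1 _ (by linarith)), Or.inl (z0 _ (by linarith))⟩
  · have h7 : coord (-s) = - coord s := by
      have key : ∀ s ∈ steps, coord (-s) = - coord s := by decide
      exact key s hs
    simp only [h7, Prod.fst_neg, Prod.snd_neg, Int.cast_neg] at h1 h2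
    have h3 : (t : ℝ) + t' = ((a * m + b * n : ℤ) : ℝ) := by
      push_cast
      linear_combination (- t - t') * hab' + a * h1 + b * h2
    have h4 : 0 ≤ a * m + b * n := by
      have : ((0 : ℤ) : ℝ) ≤ ((a * m + b * n : ℤ) : ℝ) := by rw [← h3]; push_cast; linarith
      exact_mod_cast this
    have h5 : a * m + b * n ≤ 2 := by
      have : ((a * m + b * n : ℤ) : ℝ) ≤ ((2 : ℤ) : ℝ) := by rw [← h3]; push_cast; linarith
      exact_mod_cast this
    obtain h6 | h6 | h6 : a * m + b * n = 0 ∨ a * m + b * n = 1 ∨ a * m + b * n = 2 := by omega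
    all_goals rw [h6] at h3; push_cast at h3
    · left
      exact ⟨Or.inl (z0 _ (by linarith)), Or.inl (z0 _ (by linarith))⟩
    · right; right
      exact ⟨rfl, by ext; simp; linarith⟩
    · left
      exact ⟨Or.inr (z1 _ (by linarith)), Or.inr (z1 _ (by linarith))⟩
  · left
    have hc' : ∃ c : ℤ, c * c = 1 ∧
        (coord s).1 * (coord s').2 - (coord s).2 * (coord s').1 = c := by
      rcases hc with hc | hc
      · exact ⟨1, rfl, hc⟩
      · exact ⟨-1, rfl, hc⟩
    obtain ⟨c, hcc, hc⟩ := hc'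
    have hcc' : (c * c : ℝ) = 1 := by exact_mod_cast hcc
    have hcr : ((coord s).1 * (coord s').2 - (coord s).2 * (coord s').1 : ℝ) = c := by
      exact_mod_cast hc
    constructor
    · refine eq_zero_or_eq_one_of_int (m := c * (m * (coord s').2 - n * (coord s').1)) ?_
      push_cast
      linear_combination (-t) * hcc' - t * c * hcr + c * (coord s').2 * h1 - c * (coord s').1 * h2
    · refine eq_zero_or_eq_one_of_int (m := c * (m * (coord s).2 - n * (coord s).1)) ?_
      push_cast
      linear_combination (-t') * hcc' - t' * c * hcr + c * (coord s).2 * h1 - c * (coord s).1 * h2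

/-- The straight segment that represents a dart. -/
def segment (d : Gamma37.Dart) : C(I, Torus) where
  toFun t := position d.fst + planeMap ((t : ℝ) • vec (step d))
  continuous_toFun := continuous_const.add (continuous_planeMap.comp (by fun_prop))

lemma segment_apply (d : Gamma37.Dart) (t : I) :
    segment d t = position d.fst + planeMap ((t : ℝ) • vec (step d)) := rfl

lemma segment_symm (d : Gamma37.Dart) (t : I) :
    segment d.symm t = segment d (unitInterval.symm t) := by
  have h : d.symm.fst = d.fst + step d := snd_eq d
  rw [segment_apply, segment_apply, step_symm, h, position_add, ← planeMap_vec (step_mem d),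
    add_assoc, ← planeMap_add, vec_neg (step_mem d), unitInterval.coe_symm_eq]
  congr 2
  module

lemma segment_eq_cases {d d' : Gamma37.Dart} {t t' : I} (h : segment d t = segment d' t') :
    ((t = 0 ∨ t = 1) ∧ (t' = 0 ∨ t' = 1)) ∨ (d' = d ∧ t' = t) ∨
      (d' = d.symm ∧ t' = unitInterval.symm t) := by
  rcases smul_vec_eq_cases (step_mem d) (step_mem d') (torusMk_eq_of_position_add_eq h) with
    h1 | ⟨h1, rfl⟩ | ⟨h1, h2⟩
  · exact Or.inl h1
  · right; left
    rw [segment_apply, segment_apply, h1, add_left_inj] at h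
    exact ⟨dart_ext (position_injective h.symm) h1, rfl⟩
  · right; right
    have h3 : t = unitInterval.symm t' := by rw [h2, unitInterval.symm_symm]
    rw [h3, ← segment_symm, segment_apply, segment_apply, step_symm, ← h1, add_left_inj] at h
    exact ⟨dart_ext (position_injective h.symm) (by rw [step_symm, h1]), h2⟩

/-- The embedding of `Gamma37` in the torus as a triangular grid. -/
def gridEmbedding : TorusEmbedding Gamma37 where
  pt := position
  arc := segment
  pt_injective := position_injective
  arc_zero d := by
    rw [segment_apply, Set.Icc.coe_zero, zero_smul, planeMap_zero, add_zero]
  arc_symm := segment_symm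
  arc_injective d := by
    intro t t' h
    rcases segment_eq_cases h with ⟨h1, h2⟩ | ⟨-, h1⟩ | ⟨h1, -⟩
    · have h01 : ∀ k : ZMod 37, position k ≠ position k + planeMap (vec (step d)) := by
        intro k hk
        rw [planeMap_vec (step_mem d), ← position_add] at hk
        have key : ∀ s ∈ steps, s ≠ 0 := by decide
        exact key _ (step_mem d) (left_eq_add.1 (position_injective hk))
      rcases h1 with rfl | rfl <;> rcases h2 with rfl | rfl <;>
        simp only [segment_apply, Set.Icc.coe_zero, zero_smul, planeMap_zero, add_zero,
          Set.Icc.coe_one, one_smul] at h ⊢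
      · exact (h01 _ h).elim
      · exact (h01 _ h.symm).elim
    · exact h1.symm
    · exact (d.symm_ne h1.symm).elim
  arc_eq_pt d t v h := by
    have h1 : position d.fst + planeMap ((t : ℝ) • vec (step d)) = position v + planeMap 0 := by
      rw [planeMap_zero, add_zero]
      exact h
    obtain ⟨m, n, hmn⟩ := torusMk_eq_iff.1 (torusMk_eq_of_position_add_eq h1)
    obtain ⟨h2, h3⟩ := Prod.mk.inj hmn
    simp only [vec, smul_eq_mul, Prod.fst_zero, zero_add] at h2
    simp only [vec, smul_eq_mul, Prod.snd_zero, zero_add] at h3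
    obtain ⟨a, b, hab⟩ := coord_unimodular _ (step_mem d)
    have hab' : (a * (coord (step d)).1 + b * (coord (step d)).2 : ℝ) = 1 := by exact_mod_cast hab
    refine eq_zero_or_eq_one_of_int (m := a * m + b * n) ?_
    push_cast
    linear_combination (- t) * hab' + a * h2 + b * h3
  arc_disjoint d d' s t hne h := by
    rcases segment_eq_cases h with h | ⟨rfl, -⟩ | ⟨rfl, -⟩
    · exact h
    · exact (hne rfl).elim
    · exact (hne d.edge_symm.symm).elim

lemma exists_torusMk_Ico (p : Torus) :
    ∃ x y : ℝ, 0 ≤ x ∧ x < 1 ∧ 0 ≤ y ∧ y < 1 ∧ p = torusMk (x, y) := by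
  have h : ∀ a : UnitAddCircle, ∃ x : ℝ, 0 ≤ x ∧ x < 1 ∧ (x : UnitAddCircle) = a := fun a => by
    have : a ∈ ((↑) : ℝ → UnitAddCircle) '' Set.Ico 0 (0 + 1) := by
      rw [AddCircle.coe_image_Ico_eq]; trivial
    obtain ⟨x, hx, rfl⟩ := this
    exact ⟨x, hx.1, by simpa using hx.2, rfl⟩
  obtain ⟨x, hx0, hx1, hx⟩ := h p.1
  obtain ⟨y, hy0, hy1, hy⟩ := h p.2
  exact ⟨x, y, hx0, hx1, hy0, hy1, Prod.ext hx.symm hy.symm⟩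

/-- Each step lies on one of the lines `x = 0`, `y = 0`, `x = y`; conversely, points of these
circles lie on edges of step 10, 1 and 11. -/
lemma mem_support_iff (p : Torus) : p ∈ gridEmbedding.support ↔
    (collapse p).1 = 0 ∨ (collapse p).2 = 0 ∨ (collapse p).1 = (collapse p).2 := by
  constructor
  · intro h
    have h1 : ∃ (d : Gamma37.Dart) (t : I), segment d t = p := by
      rcases h with ⟨v, rfl⟩ | h
      · obtain ⟨d, rfl⟩ := exists_dart_fst v
        exact ⟨d, 0, gridEmbedding.arc_zero d⟩
      · obtain ⟨d, t, rfl⟩ := Set.mem_iUnion.1 h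
        exact ⟨d, t, rfl⟩
    obtain ⟨d, t, rfl⟩ := h1
    rw [segment_apply, collapse_position_add]
    have key : ∀ s ∈ steps, (coord s).1 = 0 ∨ (coord s).2 = 0 ∨ (coord s).1 = (coord s).2 := by
      decide
    rcases key _ (step_mem d) with h | h | h
    · left
      simp [torusMk_apply, vec, h]
    · right; left
      simp [torusMk_apply, vec, h]
    · right; right
      simp [torusMk_apply, vec, h]
  · intro h
    obtain ⟨x, y, hx0, hx1, hy0, hy1, hxy⟩ := exists_torusMk_Ico (collapse p)
    have hx : ((x : ℝ) : UnitAddCircle) = 0 ↔ x = 0 :=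
      AddCircle.coe_eq_zero_iff_of_mem_Ico ⟨hx0, hx1⟩
    have hy : ((y : ℝ) : UnitAddCircle) = 0 ↔ y = 0 :=
      AddCircle.coe_eq_zero_iff_of_mem_Ico ⟨hy0, hy1⟩
    have hxy' : ((x : ℝ) : UnitAddCircle) = y ↔ x = y :=
      AddCircle.coe_eq_coe_iff_of_mem_Ico (p := (1 : ℝ)) (a := 0) (by simp [hx0, hx1])
        (by simp [hy0, hy1])
    obtain ⟨k, rfl⟩ := exists_eq_position_add hxy
    rw [hxy] at h
    change (x : UnitAddCircle) = 0 ∨ (y : UnitAddCircle) = 0 ∨ (x : UnitAddCircle) = y at h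
    rw [hx, hy, hxy'] at h
    have key : ∀ (s : ZMod 37) (hs : s ∈ steps) (t : ℝ) (h0 : 0 ≤ t) (h1 : t < 1),
        t • vec s = (x, y) → position k + planeMap (x, y) ∈ gridEmbedding.support := by
      intro s hs t h0 h1 h
      have h2 := gridEmbedding.arc_mem_support (dart k s hs) ⟨t, h0, h1.le⟩
      change segment _ _ ∈ _ at h2
      rw [segment_apply] at h2
      simpa [h] using h2
    rcases h with rfl | rfl | rfl
    · exact key 10 (by decide) y hy0 hy1 (by simp [vec, show coord 10 = (0, 1) from rfl])
    · exact key 1 (by decide) x hx0 hx1 (by simp [vec, show coord 1 = (1, 0) from rfl])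
    · exact key 11 (by decide) x hx0 hx1 (by simp [vec, show coord 11 = (1, 1) from rfl])

end Embedding

end Gamma37

/-! ### The faces of the grid. -/

namespace Gamma37

lemma coord_inv : ∀ s ∈ steps, coord (27 * s) = ((coord s).2, (coord s).2 - (coord s).1) := by
  decide

/-- Affine coordinates of the plane with respect to the first two sides of a triangle. -/
def frame (d : Gamma37.Dart) : (ℝ × ℝ) ≃ₜ (ℝ × ℝ) where
  toFun p := p.1 • vec (step d) + p.2 • vec (27 * step d)
  invFun x := (x.1 * ((coord (step d)).1 - (coord (step d)).2) + x.2 * (coord (step d)).2,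
    x.1 * (coord (step d)).2 - x.2 * (coord (step d)).1)
  left_inv p := by
    have h1 := coord_inv _ (step_mem d)
    have h2 : (((coord (step d)).1 * (coord (step d)).1 - (coord (step d)).1 * (coord (step d)).2 +
      (coord (step d)).2 * (coord (step d)).2 : ℤ) : ℝ) = 1 := by
      rw [coord_norm _ (step_mem d)]; simp
    push_cast at h2
    simp only [vec, h1]
    ext
    · simp
      linear_combination p.1 * h2
    · simp
      linear_combination p.2 * h2
  right_inv x := by
    have h1 := coord_inv _ (step_mem d)
    have h2 : (((coord (step d)).1 * (coord (step d)).1 - (coord (step d)).1 * (coord (step d)).2 +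
      (coord (step d)).2 * (coord (step d)).2 : ℤ) : ℝ) = 1 := by
      rw [coord_norm _ (step_mem d)]; simp
    push_cast at h2
    simp only [vec, h1]
    ext
    · simp
      linear_combination x.1 * h2
    · simp
      linear_combination x.2 * h2
  continuous_toFun := by fun_prop
  continuous_invFun := by fun_prop

lemma frame_apply (d : Gamma37.Dart) (p : ℝ × ℝ) :
    frame d p = p.1 • vec (step d) + p.2 • vec (27 * step d) := rfl

lemma cellPoint_eq (d : Gamma37.Dart) (p : ℝ × ℝ) :
    cellPoint d p = position d.fst + planeMap (frame d p) := rfl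

/-- The linear map that takes the triangular lattice to the positions of the vertices. -/
def gridHomeo : (ℝ × ℝ) ≃ₜ (ℝ × ℝ) where
  toFun x := ((4 * x.1 + 3 * x.2) / 37, (-3 * x.1 + 7 * x.2) / 37)
  invFun x := (7 * x.1 - 3 * x.2, 3 * x.1 + 4 * x.2)
  left_inv x := by ext <;> simp <;> ring
  right_inv x := by ext <;> simp <;> ring
  continuous_toFun := by fun_prop
  continuous_invFun := by fun_prop

lemma isOpenMap_cellPoint (d : Gamma37.Dart) : IsOpenMap (cellPoint d) := by
  have h1 : IsOpenMap planeMap := isOpenQuotientMap_torusMk.isOpenMap.comp gridHomeo.isOpenMap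
  exact (isOpenMap_add_left (position d.fst)).comp (h1.comp (frame d).isOpenMap)

lemma continuous_cellPoint (d : Gamma37.Dart) : Continuous (cellPoint d) :=
  continuous_const.add (continuous_planeMap.comp (frame d).continuous)

lemma isOpen_openTriangle : IsOpen openTriangle :=
  (isOpen_lt continuous_const continuous_fst).inter
    ((isOpen_lt continuous_const continuous_snd).inter
      (isOpen_lt (continuous_fst.add continuous_snd) continuous_const))

lemma convex_openTriangle : Convex ℝ openTriangle := by
  rintro x ⟨hx1, hx2, hx3⟩ y ⟨hy1, hy2, hy3⟩ a b ha hb hab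
  obtain rfl : b = 1 - a := by linarith
  refine ⟨?_, ?_, ?_⟩
  all_goals
    simp only [Prod.fst_add, Prod.snd_add, Prod.smul_fst, Prod.smul_snd, smul_eq_mul]
    rcases ha.eq_or_lt with rfl | ha
    · simp; linarith
    · nlinarith

/-- The open triangle to the side of a dart. -/
def triangle (d : Gamma37.Dart) : Set Torus := cellPoint d '' openTriangle

lemma isOpen_triangle (d : Gamma37.Dart) : IsOpen (triangle d) :=
  isOpenMap_cellPoint d _ isOpen_openTriangle

lemma isPreconnected_triangle (d : Gamma37.Dart) : IsPreconnected (triangle d) :=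
  convex_openTriangle.isPreconnected.image _ (continuous_cellPoint d).continuousOn

lemma triangle_nonempty (d : Gamma37.Dart) : (triangle d).Nonempty :=
  ⟨_, (1 / 3, 1 / 3), by norm_num [openTriangle], rfl⟩

lemma triangle_facePerm_subset (d : Gamma37.Dart) :
    triangle (rotationSystem.facePerm d) ⊆ triangle d := by
  rintro _ ⟨p, ⟨h1, h2, h3⟩, rfl⟩
  rw [cellPoint_facePerm]
  exact ⟨_, ⟨by simp only; linarith, h1, by simp only; linarith⟩, rfl⟩

lemma triangle_facePerm (d : Gamma37.Dart) :
    triangle (rotationSystem.facePerm d) = triangle d := by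
  refine (triangle_facePerm_subset d).antisymm ?_
  have h1 := triangle_facePerm_subset (rotationSystem.facePerm d)
  have h2 := triangle_facePerm_subset (rotationSystem.facePerm (rotationSystem.facePerm d))
  rw [facePerm_facePerm_facePerm] at h2
  exact h2.trans h1

lemma triangle_facePerm_iterate (d : Gamma37.Dart) (k : ℕ) :
    triangle (rotationSystem.facePerm^[k] d) = triangle d := by
  induction k with
  | zero => rfl
  | succ k ih => rw [Function.iterate_succ_apply', triangle_facePerm, ih]

lemma triangle_eq_of_sameCycle {d d' : Gamma37.Dart}
    (h : rotationSystem.facePerm.SameCycle d d') : triangle d = triangle d' := by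
  obtain ⟨k, -, rfl⟩ := rotationSystem.sameCycle_iff_exists_iterate.1 h
  exact (triangle_facePerm_iterate d k).symm

/-- A normal form for facial walks: multiplication by `-11` has two orbits on the steps, one
containing 10 and the other 11. They give the halves `x < y` and `y < x` of the unit square at `k`.
-/
lemma exists_sameCycle_dart (d : Gamma37.Dart) : ∃ (k s : ZMod 37) (hs : s ∈ steps),
    (s = 10 ∨ s = 11) ∧ rotationSystem.facePerm.SameCycle d (dart k s hs) := by
  have key : ∀ s ∈ steps, ∃ j : Fin 3, (-11) ^ (j : ℕ) * s = 10 ∨ (-11) ^ (j : ℕ) * s = 11 := by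
    decide
  obtain ⟨j, hj⟩ := key _ (step_mem d)
  rw [← step_facePerm_iterate] at hj
  refine ⟨(rotationSystem.facePerm^[j] d).fst, _, step_mem (rotationSystem.facePerm^[j] d), hj, ?_⟩
  refine ⟨(j : ℕ), ?_⟩
  rw [zpow_natCast, ← Equiv.Perm.iterate_eq_pow]
  exact dart_ext rfl (step_dart _ _ _).symm

lemma mem_triangle_ten {k : ZMod 37} {p : Torus} :
    p ∈ triangle (dart k 10 (by decide)) ↔
      ∃ x y : ℝ, 0 < x ∧ x < y ∧ y < 1 ∧ p = position k + planeMap (x, y) := by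
  have h : ∀ q, frame (dart k 10 (by decide)) q = (q.2, q.1 + q.2) := fun q => by
    rw [frame_apply, step_dart, vec, vec, show coord 10 = (0, 1) from rfl,
      show coord (27 * 10) = (1, 1) from rfl]
    simp
  constructor
  · rintro ⟨q, ⟨h1, h2, h3⟩, rfl⟩
    exact ⟨q.2, q.1 + q.2, h2, by linarith, h3, by rw [cellPoint_eq, h, dart_fst]⟩
  · rintro ⟨x, y, h1, h2, h3, rfl⟩
    refine ⟨(y - x, x), ⟨by simpa using h2, h1, by simpa using h3⟩, ?_⟩
    rw [cellPoint_eq, h, dart_fst]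
    simp

lemma mem_triangle_eleven {k : ZMod 37} {p : Torus} :
    p ∈ triangle (dart k 11 (by decide)) ↔
      ∃ x y : ℝ, 0 < y ∧ y < x ∧ x < 1 ∧ p = position k + planeMap (x, y) := by
  have h : ∀ q, frame (dart k 11 (by decide)) q = (q.1 + q.2, q.1) := fun q => by
    rw [frame_apply, step_dart, vec, vec, show coord 11 = (1, 1) from rfl,
      show coord (27 * 11) = (1, 0) from rfl]
    simp
  constructor
  · rintro ⟨q, ⟨h1, h2, h3⟩, rfl⟩
    exact ⟨q.1 + q.2, q.1, h1, by linarith, h3, by rw [cellPoint_eq, h, dart_fst]⟩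
  · rintro ⟨x, y, h1, h2, h3, rfl⟩
    refine ⟨(y, x - y), ⟨h1, by simpa using h2, by simpa using h3⟩, ?_⟩
    rw [cellPoint_eq, h, dart_fst]
    simp

lemma torusMk_injOn {x y x' y' : ℝ} (hx : x ∈ Set.Ico (0 : ℝ) 1) (hy : y ∈ Set.Ico (0 : ℝ) 1)
    (hx' : x' ∈ Set.Ico (0 : ℝ) 1) (hy' : y' ∈ Set.Ico (0 : ℝ) 1)
    (h : torusMk (x, y) = torusMk (x', y')) : x = x' ∧ y = y' := by
  have key : ∀ {a b : ℝ}, a ∈ Set.Ico (0 : ℝ) 1 → b ∈ Set.Ico (0 : ℝ) 1 →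
      (a : UnitAddCircle) = b → a = b := fun ha hb hab =>
    (AddCircle.coe_eq_coe_iff_of_mem_Ico (p := (1 : ℝ)) (a := 0) (by simpa using ha)
      (by simpa using hb)).1 hab
  exact ⟨key hx hx' (congrArg Prod.fst h), key hy hy' (congrArg Prod.snd h)⟩

/-- The points of a triangle, in lattice coordinates. -/
lemma exists_of_mem_triangle {k s : ZMod 37} {hs : s ∈ steps} (hs' : s = 10 ∨ s = 11) {p : Torus}
    (hp : p ∈ triangle (dart k s hs)) : ∃ x y : ℝ, x ∈ Set.Ioo (0 : ℝ) 1 ∧ y ∈ Set.Ioo (0 : ℝ) 1 ∧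
      (s = 10 ∧ x < y ∨ s = 11 ∧ y < x) ∧ p = position k + planeMap (x, y) := by
  rcases hs' with rfl | rfl
  · obtain ⟨x, y, h1, h2, h3, h⟩ := mem_triangle_ten.1 hp
    exact ⟨x, y, ⟨h1, by linarith⟩, ⟨by linarith, h3⟩, Or.inl ⟨rfl, h2⟩, h⟩
  · obtain ⟨x, y, h1, h2, h3, h⟩ := mem_triangle_eleven.1 hp
    exact ⟨x, y, ⟨by linarith, h3⟩, ⟨h1, by linarith⟩, Or.inr ⟨rfl, h2⟩, h⟩

/-- In normal form, `collapse` determines the coordinates in the open unit square and hence the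
half; the base vertex is then determined as well. -/
lemma sameCycle_of_mem_triangle {d d' : Gamma37.Dart} {p : Torus} (h : p ∈ triangle d)
    (h' : p ∈ triangle d') : rotationSystem.facePerm.SameCycle d d' := by
  obtain ⟨k, s, hs, hs1, hc⟩ := exists_sameCycle_dart d
  obtain ⟨k', s', hs', hs1', hc'⟩ := exists_sameCycle_dart d'
  rw [triangle_eq_of_sameCycle hc] at h
  rw [triangle_eq_of_sameCycle hc'] at h'
  obtain ⟨x, y, hx, hy, hxy, hp⟩ := exists_of_mem_triangle hs1 h
  obtain ⟨x', y', hx', hy', hxy', hp'⟩ := exists_of_mem_triangle hs1' h'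
  rw [hp] at hp'
  obtain ⟨rfl, rfl⟩ := torusMk_injOn ⟨hx.1.le, hx.2⟩ ⟨hy.1.le, hy.2⟩ ⟨hx'.1.le, hx'.2⟩
    ⟨hy'.1.le, hy'.2⟩ (torusMk_eq_of_position_add_eq hp')
  have hk : k = k' := position_injective (add_right_cancel hp')
  have hss : s = s' := by
    rcases hxy with ⟨h1, h2⟩ | ⟨h1, h2⟩ <;> rcases hxy' with ⟨h3, h4⟩ | ⟨h3, h4⟩
    · rw [h1, h3]
    · exact (lt_asymm h2 h4).elim
    · exact (lt_asymm h2 h4).elim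
    · rw [h1, h3]
  subst hk hss
  exact hc.trans hc'.symm

lemma triangle_subset_compl (d : Gamma37.Dart) : triangle d ⊆ gridEmbedding.supportᶜ := by
  intro p hp hsupp
  obtain ⟨k, s, hs, hs1, hc⟩ := exists_sameCycle_dart d
  rw [triangle_eq_of_sameCycle hc] at hp
  obtain ⟨x, y, hx, hy, hxy, rfl⟩ := exists_of_mem_triangle hs1 hp
  rw [mem_support_iff, collapse_position_add, torusMk_apply] at hsupp
  simp only at hsupp
  rw [AddCircle.coe_eq_zero_iff_of_mem_Ico ⟨hx.1.le, hx.2⟩,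
    AddCircle.coe_eq_zero_iff_of_mem_Ico ⟨hy.1.le, hy.2⟩,
    AddCircle.coe_eq_coe_iff_of_mem_Ico (p := (1 : ℝ)) (a := 0) (by simp [hx.1.le, hx.2])
        (by simp [hy.1.le, hy.2])] at hsupp
  rcases hsupp with h | h | rfl
  · exact hx.1.ne' h
  · exact hy.1.ne' h
  · rcases hxy with ⟨-, h⟩ | ⟨-, h⟩ <;> exact lt_irrefl _ h

lemma exists_mem_triangle {p : Torus} (hp : p ∉ gridEmbedding.support) : ∃ d, p ∈ triangle d := by
  obtain ⟨x, y, hx0, hx1, hy0, hy1, hxy⟩ := exists_torusMk_Ico (collapse p)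
  obtain ⟨k, rfl⟩ := exists_eq_position_add hxy
  rw [mem_support_iff, hxy, torusMk_apply] at hp
  push Not at hp
  obtain ⟨h1, h2, h3⟩ := hp
  have hx : 0 < x := hx0.lt_of_ne (by rintro rfl; simp at h1)
  have hy : 0 < y := hy0.lt_of_ne (by rintro rfl; simp at h2)
  rcases lt_trichotomy x y with h | rfl | h
  · exact ⟨_, mem_triangle_ten.2 ⟨x, y, hx, h, hy1, rfl⟩⟩
  · exact (h3 rfl).elim
  · exact ⟨_, mem_triangle_eleven.2 ⟨x, y, hy, h, hx1, rfl⟩⟩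

/-- The triangle is open and connected, and the rest of the complement is a union of other open
triangles disjoint from it. -/
lemma connectedComponentIn_eq_triangle {d : Gamma37.Dart} {p : Torus} (hp : p ∈ triangle d) :
    connectedComponentIn gridEmbedding.supportᶜ p = triangle d := by
  refine Set.Subset.antisymm ?_ ((isPreconnected_triangle d).subset_connectedComponentIn hp
    (triangle_subset_compl d))
  let W : Set Torus := ⋃ d' : {d' : Gamma37.Dart // ¬ rotationSystem.facePerm.SameCycle d d'},
    triangle d'.1
  have hW : IsOpen W := isOpen_iUnion fun d' => isOpen_triangle _
  have hdisj : Disjoint (triangle d) W := by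
    rw [Set.disjoint_left]
    intro q hq hq'
    obtain ⟨d', hd'⟩ := Set.mem_iUnion.1 hq'
    exact d'.2 (sameCycle_of_mem_triangle hq hd')
  refine isPreconnected_connectedComponentIn.subset_left_of_subset_union (isOpen_triangle d) hW
    hdisj (fun q hq => ?_) ⟨p, mem_connectedComponentIn (triangle_subset_compl d hp), hp⟩
  obtain ⟨d', hd'⟩ := exists_mem_triangle (connectedComponentIn_subset _ _ hq)
  by_cases h : rotationSystem.facePerm.SameCycle d d'
  · left
    rwa [triangle_eq_of_sameCycle h]
  · exact Or.inr (Set.mem_iUnion.2 ⟨⟨d', h⟩, hd'⟩)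

/-- Points with equal images differ by a lattice vector. The unimodular `frame` turns it into
integral differences of coordinates that lie in `(0, 1)`. -/
lemma cellPoint_injOn (d : Gamma37.Dart) : Set.InjOn (cellPoint d) openTriangle := by
  rintro p ⟨h1, h2, h3⟩ q ⟨h1', h2', h3'⟩ h
  obtain ⟨m, n, hmn⟩ := torusMk_eq_iff.1 (torusMk_eq_of_position_add_eq h)
  have h4 : (frame d).symm (frame d p) =
    q + (frame d).symm ((m : ℝ), (n : ℝ)) := by
    rw [← frame_apply, ← frame_apply] at hmn
    rw [hmn]
    conv_rhs => rw [← (frame d).symm_apply_apply q]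
    change (_, _) = (_, _) + (_, _)
    rw [Prod.mk_add_mk]
    congr 1 <;> ring
  rw [Homeomorph.symm_apply_apply] at h4
  have key : ∀ {a b : ℝ} {j : ℤ}, 0 < a → a < 1 → 0 < b → b < 1 → a = b + j → a = b := by
    intro a b j ha ha1 hb hb1 hab
    have h5 : (j : ℝ) < (1 : ℤ) := by push_cast; linarith
    have h6 : ((-1 : ℤ) : ℝ) < j := by push_cast; linarith
    rw [Int.cast_lt] at h5 h6
    obtain rfl : j = 0 := by omega
    simpa using hab
  refine Prod.ext
    (key (j := m * ((coord (step d)).1 - (coord (step d)).2) + n * (coord (step d)).2) h1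
      (by linarith) h1' (by linarith) ?_)
    (key (j := m * (coord (step d)).2 - n * (coord (step d)).1) h2 (by linarith) h2'
      (by linarith) ?_)
  · rw [h4]
    push_cast
    rfl
  · rw [h4]
    push_cast
    rfl

lemma arc_eq_cellPoint (d : Gamma37.Dart) (t : I) :
    gridEmbedding.arc d t = cellPoint d ((t : ℝ), 0) := by
  rw [cellPoint, zero_smul, add_zero]
  rfl

lemma facePerm_iterate_mod_three (d : Gamma37.Dart) (k : ℕ) :
    rotationSystem.facePerm^[k] d = rotationSystem.facePerm^[k % 3] d := by
  have h := Function.iterate_mod_minimalPeriod_eq (f := rotationSystem.facePerm) (x := d) (n := k)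
  change rotationSystem.facePerm^[k % rotationSystem.faceLength d] d = _ at h
  rw [faceLength_eq_three] at h
  exact h.symm

lemma isCell_triangle (d : Gamma37.Dart) :
    gridEmbedding.IsCell rotationSystem d (triangle d) := by
  refine ⟨fun z => cellPoint d (discToTriangle z),
    ((continuous_cellPoint d).comp continuous_discToTriangle).continuousOn,
    (cellPoint_injOn d).bijOn_image.comp bijOn_discToTriangle, fun k s => ?_⟩
  have h := discToTriangle_smul_exp k zero_le_one s.2.1 s.2.2
  simp only [Complex.ofReal_one, one_mul, one_smul, Complex.ofReal_add, Complex.ofReal_natCast,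
    Int.cast_natCast, Nat.cast_ofNat, sub_self, zero_smul, zero_add] at h
  rw [faceLength_eq_three]
  simp only [Nat.cast_ofNat]
  rw [h, facePerm_iterate_mod_three, arc_eq_cellPoint]
  have hk : k % 3 = 0 ∨ k % 3 = 1 ∨ k % 3 = 2 := by omega
  rcases hk with hk | hk | hk
  · have h1 : (k : ℤ) % 3 = 0 := by omega
    have h2 : ((k : ℤ) + 1) % 3 = 1 := by omega
    rw [hk]
    simp [corner, h1, h2]
  · have h1 : (k : ℤ) % 3 = 1 := by omega
    have h2 : ((k : ℤ) + 1) % 3 = 2 := by omega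
    rw [hk]
    simp [corner, h1, h2, cellPoint_facePerm]
  · have h1 : (k : ℤ) % 3 = 2 := by omega
    have h2 : ((k : ℤ) + 1) % 3 = 0 := by omega
    rw [hk]
    simp [corner, h1, h2, cellPoint_facePerm]

theorem gridEmbedding_isTwoCellWith : gridEmbedding.IsTwoCellWith rotationSystem := by
  refine ⟨triangle, fun d => ?_, fun U hU => ?_, fun d d' => ⟨fun h => ?_,
    triangle_eq_of_sameCycle⟩, isCell_triangle⟩
  · obtain ⟨p, hp⟩ := triangle_nonempty d
    exact ⟨p, triangle_subset_compl d hp, (connectedComponentIn_eq_triangle hp).symm⟩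
  · obtain ⟨p, hp, rfl⟩ := hU
    obtain ⟨d, hd⟩ := exists_mem_triangle hp
    exact ⟨d, (connectedComponentIn_eq_triangle hd).symm⟩
  · obtain ⟨p, hp⟩ := triangle_nonempty d
    exact sameCycle_of_mem_triangle hp (h ▸ hp)

theorem gridEmbedding_isTwoCell : gridEmbedding.IsTwoCell := ⟨_, gridEmbedding_isTwoCellWith⟩

end Gamma37

/-! ### Invariance of representativity, and winding of closed curves. -/

namespace TorusEmbedding

variable {V : Type} {G : SimpleGraph V} {e e' : TorusEmbedding G}

lemma image_support {h : Torus ≃ₜ Torus} (h1 : ∀ v, h (e.pt v) = e'.pt v)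
    (h2 : ∀ d, h '' Set.range (e.arc d) = Set.range (e'.arc d)) :
    h '' e.support = e'.support := by
  rw [support, support, Set.image_union, Set.image_iUnion, ← Set.range_comp]
  simp only [h2]
  congr 2
  exact funext h1

/-- The inverse homeomorphism carries non-contractible curves to such curves with the same
intersection parameters. -/
lemma Equivalent.representativity_le (h : e.Equivalent e') :
    e.representativity ≤ e'.representativity := by
  obtain ⟨h, h1, h2⟩ := h
  have hs := image_support h1 h2
  refine le_iInf fun γ => ?_
  let h' : C(Torus, Torus) := ⟨h.symm, h.symm.continuous⟩
  let h'' : C(Torus, Torus) := ⟨h, h.continuous⟩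
  have hγ : ¬ (h'.comp γ.1).Nullhomotopic := fun hn => γ.2 (by
    have h3 := hn.comp_right h''
    have h4 : h''.comp (h'.comp γ.1) = γ.1 := by
      ext1 t
      exact h.apply_symm_apply _
    rwa [h4] at h3)
  refine (iInf_le _ ⟨h'.comp γ.1, hγ⟩).trans (le_of_eq ?_)
  congr 1
  ext t
  change h.symm (γ.1 t) ∈ e.support ↔ γ.1 t ∈ e'.support
  rw [← hs]
  constructor
  · intro ht
    exact ⟨_, ht, h.apply_symm_apply _⟩
  · rintro ⟨x, hx, hxt⟩
    rwa [← hxt, h.symm_apply_apply]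

end TorusEmbedding

section Loops

/-- A loop on the circle lifts to a function on the line that is periodic up to an integer. -/
lemma exists_lift_loop (u : C(UnitAddCircle, UnitAddCircle)) :
    ∃ (f : C(ℝ, ℝ)) (m : ℤ), (∀ t : ℝ, (f t : UnitAddCircle) = u t) ∧ ∀ t, f (t + 1) = f t + m := by
  obtain ⟨f, hf⟩ := exists_lift_of_simplyConnected
    (u.comp ⟨((↑) : ℝ → UnitAddCircle), AddCircle.continuous_mk' 1⟩)
  have hf' : ∀ t : ℝ, (f t : UnitAddCircle) = u t := hf
  obtain ⟨m, hm⟩ := exists_int_of_coe_eq_zero (f := fun t => f (t + 1) - f t) (by fun_prop)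
    (fun t => by
      rw [AddCircle.coe_sub, hf', hf', sub_eq_zero]
      congr 1
      exact AddCircle.coe_add_period 1 t)
  exact ⟨f, m, hf', fun t => by linarith [hm t]⟩

/-- A loop on the torus whose coordinates have periodic lifts is contractible. -/
lemma nullhomotopic_of_periodic_lifts {γ : C(UnitAddCircle, Torus)} {f g : C(ℝ, ℝ)}
    (hf : ∀ t : ℝ, (f t : UnitAddCircle) = (γ t).1) (hg : ∀ t : ℝ, (g t : UnitAddCircle) = (γ t).2)
    (hf1 : Function.Periodic f 1) (hg1 : Function.Periodic g 1) : γ.Nullhomotopic := by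
  let k : C(UnitAddCircle, ℝ × ℝ) :=
    ⟨fun t => (hf1.lift t, hg1.lift t), by
      refine Continuous.prodMk ?_ ?_
      · exact continuous_coinduced_dom.2 f.continuous
      · exact continuous_coinduced_dom.2 g.continuous⟩
  have h1 : γ = torusMk.comp k := by
    ext1 t
    obtain ⟨s, rfl⟩ := QuotientAddGroup.mk_surjective t
    exact (Prod.ext (hf s) (hg s)).symm
  rw [h1]
  exact ((id_nullhomotopic (ℝ × ℝ)).comp_left k).comp_right torusMk

/-- The lift of a contractible loop is closed. -/
lemma lift_one_eq_of_nullhomotopic {u : C(UnitAddCircle, UnitAddCircle)} (hu : u.Nullhomotopic)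
    {f : C(I, ℝ)} (hf : ∀ t : I, (f t : UnitAddCircle) = u ((t : ℝ) : UnitAddCircle)) :
    f 1 = f 0 := by
  obtain ⟨y, ⟨H⟩⟩ := hu
  obtain ⟨x, rfl⟩ := QuotientAddGroup.mk_surjective y
  let H' := H.symm
  have cov := AddCircle.isCoveringMap_coe (1 : ℝ)
  -- Lifting the homotopy from the constant loop gives a lift of `u` defined on the circle itself;
  -- `f` differs from it by a constant.
  let K := cov.liftHomotopy H'.toContinuousMap (ContinuousMap.const _ x)
    (fun a => H'.apply_zero a)
  have hK : ∀ a, (K (1, a) : UnitAddCircle) = u a := fun a => by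
    have h1 := congrFun (cov.liftHomotopy_lifts H'.toContinuousMap (ContinuousMap.const _ x)
      (fun a => H'.apply_zero a)) (1, a)
    exact h1.trans (H'.apply_one a)
  have hc : Continuous fun t : I => f t - K (1, ((t : ℝ) : UnitAddCircle)) := by
    have h2 : Continuous fun t : I => ((t : ℝ) : UnitAddCircle) :=
      (AddCircle.continuous_mk' 1).comp continuous_subtype_val
    exact f.continuous.sub (K.continuous.comp (continuous_const.prodMk h2))
  obtain ⟨m, hm⟩ := exists_int_of_coe_eq_zero hc (fun t => by
    rw [AddCircle.coe_sub, hf, hK, sub_self])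
  have h0 := hm 0
  have h1 := hm 1
  have h2 : (((1 : I) : ℝ) : UnitAddCircle) = (((0 : I) : ℝ) : UnitAddCircle) := by
    rw [Set.Icc.coe_one, Set.Icc.coe_zero]
    simp
  rw [h2] at h1
  linarith

/-- By the intermediate value theorem `F` takes the `m` integers from `⌈F 0⌉` on in `[0, 1)`; they
are below `F 1`, so the end 1, which is the point 0 of the circle, is not counted. -/
lemma natCast_le_encard_of_lift {F : ℝ → ℝ} (hF : Continuous F) {m : ℕ} (h : F 1 = F 0 + m)
    {A : Set UnitAddCircle} (hA : ∀ (s : ℝ) (n : ℤ), F s = n → (s : UnitAddCircle) ∈ A) :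
    (m : ℕ∞) ≤ A.encard := by
  have h1 : ∀ i : Fin m, ∃ s ∈ Set.Ico (0 : ℝ) 1, F s = ((⌈F 0⌉ + (i : ℕ) : ℤ) : ℝ) := by
    intro i
    have h2 : F 0 ≤ ((⌈F 0⌉ + (i : ℕ) : ℤ) : ℝ) := by
      push_cast
      linarith [Int.le_ceil (F 0), Nat.cast_nonneg (α := ℝ) (i : ℕ)]
    have h3 : ((⌈F 0⌉ + (i : ℕ) : ℤ) : ℝ) < F 1 := by
      have h4 : ((i : ℕ) : ℝ) + 1 ≤ m := by exact_mod_cast i.2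
      push_cast
      linarith [Int.ceil_lt_add_one (F 0)]
    obtain ⟨s, hs, hs'⟩ := intermediate_value_Icc zero_le_one hF.continuousOn ⟨h2, h3.le⟩
    refine ⟨s, ⟨hs.1, hs.2.lt_of_ne ?_⟩, hs'⟩
    rintro rfl
    exact h3.ne' hs'
  choose s hs hFs using h1
  have hinj : Function.Injective fun i => ((s i : ℝ) : UnitAddCircle) := by
    intro i j hij
    have h2 : s i = s j := (AddCircle.coe_eq_coe_iff_of_mem_Ico (p := (1 : ℝ)) (a := 0)
      (by simpa using hs i) (by simpa using hs j)).1 hij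
    have h3 := hFs i
    rw [h2, hFs j, Int.cast_inj] at h3
    exact Fin.ext (by omega)
  have h2 : Set.range (fun i => ((s i : ℝ) : UnitAddCircle)) ⊆ A := by
    rintro _ ⟨i, rfl⟩
    exact hA _ _ (hFs i)
  refine le_trans ?_ (Set.encard_le_encard h2)
  simpa using hinj.encard_range

/-- A closed curve passes through the integers at least as often as its winding number. -/
lemma natAbs_le_encard_of_lift {F : ℝ → ℝ} (hF : Continuous F) {m : ℤ} (h : F 1 = F 0 + m)
    {A : Set UnitAddCircle} (hA : ∀ (s : ℝ) (n : ℤ), F s = n → (s : UnitAddCircle) ∈ A) :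
    (m.natAbs : ℕ∞) ≤ A.encard := by
  rcases le_total 0 m with hm | hm
  · refine natCast_le_encard_of_lift hF ?_ hA
    rw [h, Nat.cast_natAbs, abs_of_nonneg hm]
  · refine natCast_le_encard_of_lift hF.neg ?_ fun s n hs => hA s (-n) ?_
    · rw [Pi.neg_apply, Pi.neg_apply, h, Nat.cast_natAbs, abs_of_nonpos hm]
      push_cast
      ring
    · rw [Pi.neg_apply] at hs
      push_cast
      linarith

end Loops

/-! ### The representativity of the grid is seven. -/

namespace Gamma37

lemma seven_le_encard {γ : C(UnitAddCircle, Torus)} (hγ : ¬ γ.Nullhomotopic) :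
    7 ≤ {t : UnitAddCircle | γ t ∈ gridEmbedding.support}.encard := by
  obtain ⟨f, p, hf, hf1⟩ := exists_lift_loop (ContinuousMap.fst.comp γ)
  obtain ⟨g, q, hg, hg1⟩ := exists_lift_loop (ContinuousMap.snd.comp γ)
  have hγt : ∀ t : ℝ, collapse (γ t) = torusMk (7 * f t - 3 * g t, 3 * f t + 4 * g t) := fun t => by
    have h1 : γ t = torusMk (f t, g t) := Prod.ext (hf t).symm (hg t).symm
    rw [h1, collapse_torusMk]
  have hf01 : f 1 = f 0 + p := by simpa using hf1 0
  have hg01 : g 1 = g 0 + q := by simpa using hg1 0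
  have ha := natAbs_le_encard_of_lift (F := fun t => 7 * f t - 3 * g t) (by fun_prop)
    (m := 7 * p - 3 * q) (by simp only [hf01, hg01]; push_cast; ring)
    (A := {t : UnitAddCircle | γ t ∈ gridEmbedding.support}) (fun s n hs => by
      refine (mem_support_iff _).2 (Or.inl ?_)
      rw [hγt, torusMk_apply]
      simp only [hs]
      exact unitAddCircle_coe_int n)
  have hb := natAbs_le_encard_of_lift (F := fun t => 3 * f t + 4 * g t) (by fun_prop)
    (m := 3 * p + 4 * q) (by simp only [hf01, hg01]; push_cast; ring)
    (A := {t : UnitAddCircle | γ t ∈ gridEmbedding.support}) (fun s n hs => by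
      refine (mem_support_iff _).2 (Or.inr (Or.inl ?_))
      rw [hγt, torusMk_apply]
      simp only [hs]
      exact unitAddCircle_coe_int n)
  have hc := natAbs_le_encard_of_lift (F := fun t => 4 * f t - 7 * g t) (by fun_prop)
    (m := 4 * p - 7 * q) (by simp only [hf01, hg01]; push_cast; ring)
    (A := {t : UnitAddCircle | γ t ∈ gridEmbedding.support}) (fun s n hs => by
      refine (mem_support_iff _).2 (Or.inr (Or.inr ?_))
      rw [hγt, torusMk_apply]
      exact unitAddCircle_coe_eq_coe_iff.2 ⟨n, by simp only; linarith⟩)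
  -- If all three were at most 6, then `37p = 4(7p - 3q) + 3(3p + 4q)` would give `|p| ≤ 1`, which
  -- leaves only `p = q = 0`.
  have key : 7 ≤ (7 * p - 3 * q).natAbs ∨ 7 ≤ (3 * p + 4 * q).natAbs ∨
      7 ≤ (4 * p - 7 * q).natAbs := by
    by_contra hcon
    have hp : p = 0 ∧ q = 0 := by
      have hp0 : -1 ≤ p := by omega
      have hp1 : p ≤ 1 := by omega
      interval_cases p <;> omega
    refine hγ (nullhomotopic_of_periodic_lifts hf hg (fun t => ?_) (fun t => ?_))
    · rw [hf1, hp.1, Int.cast_zero, add_zero]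
    · rw [hg1, hp.2, Int.cast_zero, add_zero]
  rcases key with h | h | h
  · exact le_trans (by exact_mod_cast h) ha
  · exact le_trans (by exact_mod_cast h) hb
  · exact le_trans (by exact_mod_cast h) hc

/-- A lift of a closed curve on the torus that meets the graph in seven points. -/
def zigzag (t : ℝ) : ℝ × ℝ := (7 * t, min (7 * t / 2) ((13 - 7 * t) / 2))

lemma continuous_zigzag : Continuous zigzag := by
  unfold zigzag
  fun_prop

/-- A closed curve on the torus that meets the graph in seven points. -/
def zigzagLoop : C(UnitAddCircle, Torus) where
  toFun := AddCircle.liftIco 1 0 fun t => planeMap (zigzag t)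
  continuous_toFun := by
    refine AddCircle.liftIco_continuous ?_ (continuous_planeMap.comp continuous_zigzag).continuousOn
    -- The ends `(0, 0)` and `(7, 3)` are the same vertex, as `7 + 10 · 3 = 37`.
    have h0 : zigzag 0 = (((0 : ℤ) : ℝ), ((0 : ℤ) : ℝ)) := by norm_num [zigzag]
    have h1 : zigzag (0 + 1) = (((7 : ℤ) : ℝ), ((3 : ℤ) : ℝ)) := by norm_num [zigzag]
    rw [h0, h1, planeMap_intCast, planeMap_intCast]
    rfl

lemma zigzagLoop_coe {t : ℝ} (h0 : 0 ≤ t) (h1 : t < 1) :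
    zigzagLoop t = planeMap (zigzag t) := by
  change AddCircle.liftIco 1 0 (fun t => planeMap (zigzag t)) (t : UnitAddCircle) = _
  exact AddCircle.liftIco_coe_apply ⟨h0, by simpa using h1⟩

lemma planeMap_fst (x : ℝ × ℝ) :
    (planeMap x).1 = (((4 * x.1 + 3 * x.2) / 37 : ℝ) : UnitAddCircle) := rfl

/-- The lift of the first coordinate runs from 0 to 1. -/
lemma zigzagLoop_not_nullhomotopic : ¬ zigzagLoop.Nullhomotopic := by
  intro h
  let f : C(I, ℝ) := ⟨fun t => (4 * (zigzag t).1 + 3 * (zigzag t).2) / 37, by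
    have := continuous_zigzag
    fun_prop⟩
  have hf0 : f 0 = 0 := by norm_num [f, zigzag]
  have hf1 : f 1 = 1 := by norm_num [f, zigzag]
  have h1 := lift_one_eq_of_nullhomotopic (h.comp_right ContinuousMap.fst) (f := f) fun t => by
    change _ = (zigzagLoop ((t : ℝ) : UnitAddCircle)).1
    rcases t.2.2.lt_or_eq with ht | ht
    · rw [zigzagLoop_coe t.2.1 ht, planeMap_fst]
      rfl
    · obtain rfl : t = 1 := Subtype.ext ht
      have h2 : (((1 : I) : ℝ) : UnitAddCircle) = ((0 : ℝ) : UnitAddCircle) := by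
        rw [Set.Icc.coe_one]
        simp
      rw [h2, zigzagLoop_coe le_rfl one_pos, planeMap_fst, hf1]
      norm_num [zigzag]
  rw [hf0, hf1] at h1
  exact one_ne_zero h1

/-- Up to `x = 13/2` the curve has slope `1/2` and meets the graph only where `x` is an integer: at
vertices for even `x`, at midpoints of edges for odd `x`. On the way back down to `(7, 3)` both `y`
and `x - y` stay strictly between 3 and 4. -/
lemma encard_zigzagLoop_le :
    {t : UnitAddCircle | zigzagLoop t ∈ gridEmbedding.support}.encard ≤ 7 := by
  classical
  let S : Finset UnitAddCircle :=
    (Finset.range 7).image fun j : ℕ => ((j / 7 : ℝ) : UnitAddCircle)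
  have hS : {t : UnitAddCircle | zigzagLoop t ∈ gridEmbedding.support} ⊆ S := by
    intro t ht
    have ht' : t ∈ ((↑) : ℝ → UnitAddCircle) '' Set.Ico 0 (0 + 1) := by
      rw [AddCircle.coe_image_Ico_eq]; trivial
    obtain ⟨s, ⟨hs0, hs1⟩, rfl⟩ := ht'
    rw [zero_add] at hs1
    have hz : ∃ n : ℤ, 7 * s = n := by
      have h := (mem_support_iff _).1 ht
      rw [zigzagLoop_coe hs0 hs1, collapse_planeMap, torusMk_apply] at h
      simp only [zigzag] at h
      rw [unitAddCircle_coe_eq_zero_iff, unitAddCircle_coe_eq_zero_iff,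
        unitAddCircle_coe_eq_coe_iff] at h
      have habs : ∀ n : ℤ, (3 : ℝ) < n → (n : ℝ) < 4 → False := by
        intro n h3 h4
        have h3' : 3 < n := by exact_mod_cast h3
        have h4' : n < 4 := by exact_mod_cast h4
        omega
      rcases le_or_gt (7 * s) (13 / 2) with hs | hs
      · rw [min_eq_left (by linarith)] at h
        rcases h with h | ⟨n, h⟩ | ⟨n, h⟩
        · exact h
        · exact ⟨2 * n, by push_cast; linarith⟩
        · exact ⟨2 * n, by push_cast; linarith⟩
      · rw [min_eq_right (by linarith)] at h
        rcases h with h | ⟨n, h⟩ | ⟨n, h⟩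
        · exact h
        · exact (habs n (by linarith) (by linarith)).elim
        · exact (habs n (by linarith) (by linarith)).elim
    obtain ⟨n, hn⟩ := hz
    have hn0 : 0 ≤ n := by
      have : (0 : ℝ) ≤ n := by linarith
      exact_mod_cast this
    have hn7 : n < 7 := by
      have : (n : ℝ) < 7 := by linarith
      exact_mod_cast this
    lift n to ℕ using hn0
    refine Finset.mem_coe.2 (Finset.mem_image.2 ⟨n, Finset.mem_range.2 (by omega), ?_⟩)
    congr 1
    rw [Int.cast_natCast] at hn
    linarith
  refine (Set.encard_le_encard hS).trans ?_
  rw [Set.encard_coe_eq_coe_finsetCard]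
  exact_mod_cast Finset.card_image_le.trans_eq (Finset.card_range 7)

lemma representativity_gridEmbedding : gridEmbedding.representativity = 7 := by
  rw [TorusEmbedding.representativity]
  refine le_antisymm ?_ (le_iInf fun γ => seven_le_encard γ.2)
  exact iInf_le_of_le ⟨zigzagLoop, zigzagLoop_not_nullhomotopic⟩ encard_zigzagLoop_le

theorem representativity_eq {e : TorusEmbedding Gamma37} (h : e.IsTwoCell) :
    e.representativity = 7 := by
  rw [← representativity_gridEmbedding]
  exact le_antisymm (equivalent h gridEmbedding_isTwoCell).representativity_le
    (equivalent gridEmbedding_isTwoCell h).representativity_le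

end Gamma37

end

theorem proposition10 :
    (∀ R : RotationSystem Gamma37, R.eulerChar ≤ 0) ∧
    (∃ e : TorusEmbedding Gamma37, e.IsTwoCell) ∧
    (∀ e e' : TorusEmbedding Gamma37, e.IsTwoCell → e'.IsTwoCell → e.Equivalent e') ∧
    (∀ e : TorusEmbedding Gamma37, e.IsTwoCell →
      e.IsEulerianTriangulation ∧ e.representativity = 7) := by
  exact ⟨Gamma37.eulerChar_nonpos, ⟨_, Gamma37.gridEmbedding_isTwoCell⟩,
    fun e e' => Gamma37.equivalent,
    fun e he => ⟨Gamma37.isEulerianTriangulation he, Gamma37.representativity_eq he⟩⟩
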